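/- Let $\Sigma$ be a finite alphabet. Starting from the pool of all letters of $\Sigma$, an assembly step concatenates two words of the current pool and adds the result to the pool; words may be reused arbitrarily often. For a nonempty word $w$ let $\mathrm{ASI}(w)$ be the least number of assembly steps after which $w$ is in the pool. ASI-DEC is the problem: given $(w,k)$ with $w\in\Sigma^+$ of length $n=|w|$ and $k\in\mathbb N$ encoded in binary (so that the input size is $n+\Theta(\log k)$), decide whether $\mathrm{ASI}(w)\le k$. Then ASI-DEC is in NP. More precisely, in addition to membership in NP (with respect to polynomial-time Turing machines), the following hold. (1) If $k\ge n-1$, then $(w,k)$ is a yes-instance. (2) If $k\le n-2$, then $(w,k)$ is a yes-instance if and only if there is an assembly plan of $t\le k$ steps $X_i:=U_i\circ V_i$ ($1\le i\le t$), in which each of $U_i,V_i$ is given by a pointer, either to a letter of $\Sigma$ or to some $X_j$ with $j<i$, and in which the last word $X_t$ equals $w$. Such plans can be encoded with $O(n\log n)$ bits. (3) Such plans can be checked in time $O(n^2)$: for each size of $\Sigma$ there are a program for a random access machine (instructions: constants, copying, addition, subtraction, indirect load and store, conditional jumps; each of unit cost) and a constant $C$ such that for every $(w,k)$ with $k\le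 n-2$ and every finite sequence of pairs of pointers (legal or not, of any length), the program, started with $(w,k)$ and this sequence in its memory, decides within $Cn^2$ steps whether the sequence is a plan for $w$ as in (2). No number that occurs in the computation exceeds the maximum of $Cn^2$ and the largest number in the input. -/

import Mathlib

/-! ### The assembly index of a word -/

namespace Assembly

/-- `Pool t P`: after `t` assembly steps the pool of available words can be `P`. Initially the pool
consists of the letters; a step joins two available words and adds the result to the pool. -/
inductive Pool {α : Type} : ℕ → Set (List α) → Prop
  | init : Pool 0 {x | ∃ a : α, x = [a]}
  | step {t : ℕ} {P : Set (List α)} {u v : List α} :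
      Pool t P → u ∈ P → v ∈ P → Pool (t + 1) (insert (u ++ v) P)

/-- The assembly index: the least number of assembly steps after which `w` is available
(it is `⊤` if `w` cannot be assembled, which only happens for the empty word). -/
noncomputable def asi {α : Type} (w : List α) : ℕ∞ :=
  ⨅ (t : ℕ) (_ : ∃ P : Set (List α), Pool t P ∧ w ∈ P), (t : ℕ∞)

/-- The yes-instances `(w, k)` of the decision problem: `w` is nonempty and `ASI(w) ≤ k`. -/
def ASIDec (α : Type) : Set (List α × ℕ) :=
  {x | x.1 ≠ [] ∧ asi x.1 ≤ (x.2 : ℕ∞)}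

/-- An instance as a string: the letters of `w`, followed by the binary digits of `k`
(least significant digit first). Its length is `|w|` plus the number of binary digits of `k`. -/
def encodeInstance {α : Type} (w : List α) (k : ℕ) : List (α ⊕ Bool) :=
  w.map Sum.inl ++ k.bits.map Sum.inr

/-- The decision problem as a formal language. -/
def asiDecLanguage (α : Type) : Language (α ⊕ Bool) :=
  {x | ∃ w k, (w, k) ∈ ASIDec α ∧ x = encodeInstance w k}

/-! ### Assembly plans given by pointers -/

/-- A pointer to a letter, or to the result of step number `j` (steps are numbered from `0`). -/
inductive Ptr (α : Type) : Type
  | letter (a : α) : Ptr α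
  | step (j : ℕ) : Ptr α

/-- A (raw) plan: the list of the pairs of pointers to the two words joined in each step.
Whether the pointers are legal is not part of the type. -/
abbrev Plan (α : Type) : Type := List (Ptr α × Ptr α)

/-- The word that a pointer refers to, if the results of the steps so far are `xs`. -/
def Ptr.resolve {α : Type} (xs : List (List α)) : Ptr α → Option (List α)
  | .letter a => some [a]
  | .step j => xs[j]?

/-- Carry out the remaining steps of a plan, the results of the steps so far being `xs`;
`none` if some pointer does not refer to an earlier step. -/
def Plan.evalFrom {α : Type} (xs : List (List α)) : Plan α → Option (List (List α))
  | [] => some xs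
  | (p, q) :: rest =>
    match p.resolve xs, q.resolve xs with
    | some u, some v => Plan.evalFrom (xs ++ [u ++ v]) rest
    | _, _ => none

/-- The plan is legal, and the word formed in its last step is `w`. -/
def Plan.Builds {α : Type} (p : Plan α) (w : List α) : Prop :=
  ∃ xs, Plan.evalFrom [] p = some xs ∧ xs.getLast? = some w

/-- The number that represents a pointer, for a numbering `e` of the alphabet. -/
def Ptr.code {α : Type} {s : ℕ} (e : α ≃ Fin s) : Ptr α → ℕ
  | .letter a => (e a : ℕ)
  | .step j => s + j

/-- A plan as a sequence of numbers, two for each step. -/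
def Plan.codes {α : Type} {s : ℕ} (e : α ≃ Fin s) (p : Plan α) : List ℕ :=
  p.flatMap fun x => [x.1.code e, x.2.code e]

/-- A plan as a bit string: each pointer of a `t`-step plan is written with as many bits as
`s + t` has (the pointers of a legal plan have codes below `s + t`). -/
def Plan.bits {α : Type} {s : ℕ} (e : α ≃ Fin s) (p : Plan α) : List Bool :=
  (Plan.codes e p).flatMap fun c => (List.range (Nat.size (s + p.length))).map fun i => c.testBit i

end Assembly

/-! ### The class NP, over Mathlib's multi-stack Turing machines -/

/-- `L` is in NP: there are a finite certificate alphabet, a polynomial bound on the length of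
certificates, and a verifier running in polynomial time on a Turing machine. -/
def InNP {Γ : Type} (L : Language Γ) : Prop :=
  ∃ (Δ : Type) (_ : Fintype Δ) (bound : Polynomial ℕ) (V : List Γ × List Δ → Bool),
    Nonempty (Turing.TM2ComputableInPolyTime
      (fun xy : List Γ × List Δ => xy.1.map Sum.inl ++ xy.2.map (Sum.inr : Δ → Γ ⊕ Δ))
      Computability.encodeBool V) ∧
    ∀ x : List Γ, x ∈ L ↔ ∃ y : List Δ, y.length ≤ bound.eval x.length ∧ V (x, y) = true

/-! ### Random access machines -/

namespace RAM

/-- Instructions; `d`, `a`, `b` are names of registers. There is no multiplication. -/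
inductive Instr : Type
  /-- `reg d := v` -/
  | const (d v : ℕ) : Instr
  /-- `reg d := reg a` -/
  | move (d a : ℕ) : Instr
  /-- `reg d := reg a + reg b` -/
  | add (d a b : ℕ) : Instr
  /-- `reg d := reg a - reg b`, truncated at `0` -/
  | sub (d a b : ℕ) : Instr
  /-- `reg d := mem (reg a)` -/
  | load (d a : ℕ) : Instr
  /-- `mem (reg a) := reg b` -/
  | store (a b : ℕ) : Instr
  /-- go to instruction `l` -/
  | jump (l : ℕ) : Instr
  /-- go to instruction `l` if `reg a < reg b` -/
  | jumpLT (a b l : ℕ) : Instr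
  /-- go to instruction `l` if `reg a = reg b` -/
  | jumpEQ (a b l : ℕ) : Instr
  /-- stop with the answer `ans` -/
  | halt (ans : Bool) : Instr

abbrev Program : Type := List Instr

/-- Program counter, registers, and memory. -/
structure Cfg : Type where
  pc : ℕ
  reg : ℕ → ℕ
  mem : ℕ → ℕ

/-- One step; `none` if the machine has stopped. -/
def step (P : Program) (c : Cfg) : Option Cfg :=
  match P[c.pc]? with
  | none => none
  | some (.const d v) => some ⟨c.pc + 1, Function.update c.reg d v, c.mem⟩
  | some (.move d a) => some ⟨c.pc + 1, Function.update c.reg d (c.reg a), c.mem⟩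
  | some (.add d a b) => some ⟨c.pc + 1, Function.update c.reg d (c.reg a + c.reg b), c.mem⟩
  | some (.sub d a b) => some ⟨c.pc + 1, Function.update c.reg d (c.reg a - c.reg b), c.mem⟩
  | some (.load d a) => some ⟨c.pc + 1, Function.update c.reg d (c.mem (c.reg a)), c.mem⟩
  | some (.store a b) => some ⟨c.pc + 1, c.reg, Function.update c.mem (c.reg a) (c.reg b)⟩
  | some (.jump l) => some ⟨l, c.reg, c.mem⟩
  | some (.jumpLT a b l) => some ⟨if c.reg a < c.reg b then l else c.pc + 1, c.reg, c.mem⟩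
  | some (.jumpEQ a b l) => some ⟨if c.reg a = c.reg b then l else c.pc + 1, c.reg, c.mem⟩
  | some (.halt _) => none

/-- The start: all registers are `0`, the memory holds the input from address `0` on, and is `0`
elsewhere. -/
def init (input : List ℕ) : Cfg := ⟨0, fun _ => 0, fun i => input.getD i 0⟩

/-- The configuration after `m` steps, if the machine makes that many. -/
def run (P : Program) (input : List ℕ) (m : ℕ) : Option Cfg :=
  (fun o => o.bind (step P))^[m] (some (init input))

/-- Within `T` steps the program stops with the answer whether `φ` holds. -/
def DecidesWithin (P : Program) (input : List ℕ) (φ : Prop) (T : ℕ) : Prop :=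
  ∃ m ≤ T, ∃ c : Cfg, ∃ ans : Bool,
    run P input m = some c ∧ P[c.pc]? = some (.halt ans) ∧ (ans = true ↔ φ)

/-- No register and no memory cell (hence also no address) ever exceeds `W`. -/
def WordsBoundedBy (P : Program) (input : List ℕ) (W : ℕ) : Prop :=
  ∀ m c, run P input m = some c → (∀ i, c.reg i ≤ W) ∧ ∀ i, c.mem i ≤ W

end RAM

namespace Assembly

/-- The input of a verifier that runs on a random access machine: the length of `w`, the bound `k`,
the number of steps of the plan, the letters of `w`, and the pointers of the plan. -/
def verifierInput {α : Type} {s : ℕ} (e : α ≃ Fin s) (w : List α) (k : ℕ) (p : Plan α) : List ℕ :=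
  [w.length, k, p.length] ++ w.map (fun a => (e a : ℕ)) ++ Plan.codes e p

end Assembly

/-!
A pool reachable in `t` steps is determined by the sequence of the results of the steps, and naming
the two words joined in each step by pointers turns such a sequence into a plan. Assembling `w`
letter by letter takes `|w| - 1` steps.

For membership in NP, the certificate is a sequence of commands that dictates the words of an
assembly sequence symbol by symbol and copies earlier words where they are reused. A machine that
reads instance and certificate once, keeping words and counter on stacks, can follow it; such a
machine is simulated by a `TM2` machine with linear overhead. It pays one unit of the counter,
loaded with `k`, whenever it extends a nonempty word, that is, for each assembly step. Words longer
than `w` can be dropped from an assembly sequence, so certificates of polynomial length suffice.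

To check a plan, a random access machine first tests that all pointers refer backwards and then
expands the last step depth first, comparing letters with `w`. Every pointer stands for a nonempty
word, so the current position plus the height of the stack may not exceed `n = |w|`. Each expansion
raises `2 * position + height`, which never exceeds `2 * n`, so this takes time linear in `n`.
-/

/-- A deterministic machine with finitely many stacks that reads its input once, from left to right,
and in each step replaces the top symbol of each of its stacks by at most two symbols. It is an
intermediate model: a step may depend on all the tops at once, and there are no control labels. -/
structure StackMachine (A : Type) where
  /-- the states -/
  Q : Type
  /-- the names of the stacks -/
  K : Type
  /-- the alphabets of the stacks -/
  S : K → Type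
  [finQ : Fintype Q]
  [finK : Fintype K]
  [decK : DecidableEq K]
  [finS : ∀ k, Fintype (S k)]
  /-- the initial state -/
  start : Q
  /-- the effect of reading a symbol on the state and the stacks -/
  next : Q → A → (∀ k, List (S k)) → Q × ∀ k, List (S k)
  /-- the accepting states -/
  acc : Q → Bool
  /-- A step depends only on the tops of the stacks and leaves what is below unchanged. -/
  next_eq : ∀ q a s, next q a s = ((next q a fun k => (s k).take 1).1,
    fun k => (next q a fun k => (s k).take 1).2 k ++ (s k).drop 1)
  length_next_le : ∀ q a s, (∀ k, (s k).length ≤ 1) → ∀ k, ((next q a s).2 k).length ≤ 2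

namespace StackMachine

open Turing Function

variable {A : Type} (M : StackMachine A)

instance : Fintype M.Q := M.finQ
instance : Fintype M.K := M.finK
instance : DecidableEq M.K := M.decK
instance (k : M.K) : Fintype (M.S k) := M.finS k

/-- The state and the stacks after reading `x`, starting from `c`. -/
def runFrom (c : M.Q × ∀ k, List (M.S k)) (x : List A) : M.Q × ∀ k, List (M.S k) :=
  x.foldl (fun c a => M.next c.1 a c.2) c

/-- Whether the machine, started with empty stacks, is in an accepting state after reading `x`. -/
def accepts (x : List A) : Bool := M.acc (M.runFrom (M.start, fun _ => []) x).1

theorem length_next_le_add_two (q : M.Q) (a : A) (s : ∀ k, List (M.S k)) (m : ℕ)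
    (hs : ∀ k, (s k).length ≤ m) (k : M.K) : ((M.next q a s).2 k).length ≤ m + 2 := by
  rw [M.next_eq]
  have htop := M.length_next_le q a (fun k => (s k).take 1) (fun k => by simp) k
  have hbelow := hs k
  simp only [List.length_append, List.length_drop]
  omega

/-- The stack alphabets of the simulating `TM2` machine: its stacks are the input (`none`), the
output (`some none`) and the stacks of `M`. -/
abbrev Symbol : Option (Option M.K) → Type
  | none => A
  | some none => Bool
  | some (some k) => M.S k

/-- The internal state of the simulating `TM2` machine: the state of `M`, the symbol just read, and
the symbols popped from the stacks. -/
structure Store where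
  /-- the state of the simulated machine -/
  q : M.Q
  /-- the input symbol just read -/
  read : Option A
  /-- the symbols popped from the stacks -/
  tops : ∀ k, Option (M.S k)

noncomputable instance [Fintype A] : Fintype M.Store := by
  classical
  exact Fintype.ofInjective
    (fun v : M.Store => ((v.q, v.read, v.tops) : M.Q × Option A × ∀ k, Option (M.S k)))
    fun v w h => by cases v; cases w; simpa using h

/-- The store between two simulated steps. -/
abbrev idle (q : M.Q) : M.Store := ⟨q, none, fun _ => none⟩

/-- The statements of the simulating `TM2` machine. Its labels are `none` for the simulation, and
`some b` for emptying the stacks once the answer `b` is known. -/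
abbrev Stmt : Type := TM2.Stmt M.Symbol (Option Bool) M.Store

/-- Pop the stacks in `l` into the store, then continue with `next`. -/
def popAll : List M.K → M.Stmt → M.Stmt
  | [], next => next
  | k :: l, next =>
    .pop (some (some k)) (fun v t => { v with tops := update v.tops k t }) (popAll l next)

open Classical in
/-- Push `g` of the store, if there is such a symbol, onto stack `k`, then continue with `next`. -/
noncomputable def pushOpt (k : M.K) (g : M.Store → Option (M.S k)) (next : M.Stmt) : M.Stmt :=
  if h : Nonempty (M.S k) then
    .branch (fun v => (g v).isSome) (.push (some (some k)) (fun v => (g v).getD h.some) next) next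
  else next

/-- Push the words `r` of the store, of at most two symbols each, onto the stacks in `l`, then
continue with `next`. -/
noncomputable def pushAll (r : M.Store → ∀ k, List (M.S k)) : List M.K → M.Stmt → M.Stmt
  | [], next => next
  | k :: l, next =>
    M.pushOpt k (fun v => (r v k)[1]?) (M.pushOpt k (fun v => (r v k)[0]?) (pushAll r l next))

/-- The stacks of the simulating machine with input `x`, output `o` and simulated stacks `s`. -/
def allStacks (x : List A) (o : List Bool) (s : ∀ k, List (M.S k)) : ∀ k, List (M.Symbol k)
  | none => x
  | some none => o
  | some (some k) => s k

theorem update_allStacks_input (x y : List A) (o : List Bool) (s : ∀ k, List (M.S k)) :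
    update (M.allStacks x o s) none y = M.allStacks y o s := by
  funext j
  rcases j with _ | _ | j <;> simp [allStacks]

theorem update_allStacks_output (x : List A) (o p : List Bool) (s : ∀ k, List (M.S k)) :
    update (M.allStacks x o s) (some none) p = M.allStacks x p s := by
  funext j
  rcases j with _ | _ | j <;> simp [allStacks]

theorem update_allStacks_some (x : List A) (o : List Bool) (s : ∀ k, List (M.S k)) (k : M.K)
    (l : List (M.S k)) :
    update (M.allStacks x o s) (some (some k)) l = M.allStacks x o (update s k l) := by
  funext j
  rcases j with _ | _ | j
  · rfl
  · rfl
  · by_cases h : j = k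
    · subst h
      simp [allStacks]
    · simp [allStacks, h]

theorem stepAux_popAll (l : List M.K) (hl : l.Nodup) (next : M.Stmt) (v : M.Store) (x : List A)
    (o : List Bool) (s : ∀ k, List (M.S k)) :
    TM2.stepAux (M.popAll l next) v (M.allStacks x o s) =
      TM2.stepAux next ⟨v.q, v.read, fun k => if k ∈ l then (s k).head? else v.tops k⟩
        (M.allStacks x o fun k => if k ∈ l then (s k).tail else s k) := by
  induction l generalizing v s with
  | nil => simp [popAll]
  | cons k l ih =>
    rw [List.nodup_cons] at hl
    rw [popAll, TM2.stepAux, update_allStacks_some, ih hl.2]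
    congr 2 <;> funext j <;> by_cases h : j = k
    · subst h
      simp [hl.1, allStacks]
    · simp [h]
    · subst h
      simp [hl.1, allStacks]
    · simp [h]

theorem stepAux_pushOpt (k : M.K) (g : M.Store → Option (M.S k)) (next : M.Stmt) (v : M.Store)
    (x : List A) (o : List Bool) (s : ∀ k, List (M.S k)) :
    TM2.stepAux (M.pushOpt k g next) v (M.allStacks x o s) =
      TM2.stepAux next v (M.allStacks x o (update s k ((g v).toList ++ s k))) := by
  unfold pushOpt
  split_ifs with h
  · rw [TM2.stepAux]
    cases hg : g v with
    | none => simp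
    | some a =>
      simp only [Option.isSome_some, cond_true, TM2.stepAux, update_allStacks_some, hg]
      rfl
  · have hg : g v = none := Option.eq_none_iff_forall_ne_some.2 fun a _ => h ⟨a⟩
    simp [hg]

theorem stepAux_pushAll (r : M.Store → ∀ k, List (M.S k)) (l : List M.K) (hl : l.Nodup)
    (next : M.Stmt) (v : M.Store) (hr : ∀ k, (r v k).length ≤ 2) (x : List A) (o : List Bool)
    (s : ∀ k, List (M.S k)) :
    TM2.stepAux (M.pushAll r l next) v (M.allStacks x o s) =
      TM2.stepAux next v (M.allStacks x o fun k => if k ∈ l then r v k ++ s k else s k) := by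
  induction l generalizing s with
  | nil => simp [pushAll]
  | cons k l ih =>
    rw [List.nodup_cons] at hl
    rw [pushAll, stepAux_pushOpt, stepAux_pushOpt, ih hl.2]
    congr 2
    funext j
    by_cases h : j = k
    · subst h
      have := hr j
      rcases hj : r v j with _ | ⟨a, _ | ⟨b, _ | _⟩⟩ <;> simp_all
    · simp [h]

/-- The step of `M` as a function of the popped symbols: the new state, and what to push. -/
def result (v : M.Store) : M.Q × ∀ k, List (M.S k) :=
  match v.read with
  | none => (v.q, fun _ => [])
  | some a => M.next v.q a fun k => (v.tops k).toList

theorem mem_toList_univ (k : M.K) : k ∈ (Finset.univ : Finset M.K).toList := by simp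

open Classical in
/-- The program of the simulating machine. -/
noncomputable def prog : Option Bool → M.Stmt
  | none =>
    .pop none (fun v t => { v with read := t }) <|
      .branch (fun v => v.read.isNone) (.goto fun v => some (M.acc v.q)) <|
        M.popAll Finset.univ.toList <|
          M.pushAll (fun v => (M.result v).2) Finset.univ.toList <|
            .load (fun v => M.idle (M.result v).1) <|
              .goto fun _ => none
  | some b =>
    M.popAll Finset.univ.toList <|
      .branch (fun v => decide (∀ k, v.tops k = none))
        (.load (fun _ => M.idle M.start) <| .push (some none) (fun _ => b) .halt)
        (.goto fun _ => some b)

/-- The simulating machine: each step of `M` becomes one step, after which the stacks are emptied,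
as `TM2` machines have to leave nothing but their output. -/
noncomputable def toTM2 [Fintype A] : FinTM2 where
  K := Option (Option M.K)
  k₀ := none
  k₁ := some none
  Γ := M.Symbol
  Λ := Option Bool
  main := none
  σ := M.Store
  initialState := M.idle M.start
  Γk₀Fin := inferInstanceAs (Fintype A)
  m := M.prog

theorem step_read (a : A) (x : List A) (q : M.Q) (s : ∀ k, List (M.S k)) :
    TM2.step M.prog ⟨some none, M.idle q, M.allStacks (a :: x) [] s⟩ =
      some ⟨some none, M.idle (M.next q a s).1, M.allStacks x [] (M.next q a s).2⟩ := by
  have hs : (fun k => (s k).take 1) = fun k => (s k).head?.toList := by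
    funext k
    cases s k <;> simp
  have hlen : ∀ k, ((M.next q a fun k => (s k).take 1).2 k).length ≤ 2 :=
    M.length_next_le q a _ fun k => by simp
  rw [TM2.step, prog, TM2.stepAux, TM2.stepAux]
  simp only [allStacks, List.head?_cons, Option.isNone_some, cond_false, List.tail_cons]
  rw [update_allStacks_input, stepAux_popAll _ _ (Finset.nodup_toList _),
    stepAux_pushAll _ _ _ (Finset.nodup_toList _)]
  · rw [M.next_eq q a s]
    simp only [mem_toList_univ, if_true, TM2.stepAux, result, hs, List.drop_one]
  · simpa only [mem_toList_univ, if_true, result, hs] using hlen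

theorem step_end (q : M.Q) (s : ∀ k, List (M.S k)) :
    TM2.step M.prog ⟨some none, M.idle q, M.allStacks [] [] s⟩ =
      some ⟨some (some (M.acc q)), M.idle q, M.allStacks [] [] s⟩ := by
  rw [TM2.step, prog, TM2.stepAux, TM2.stepAux]
  simp [allStacks, update_allStacks_input]

theorem step_clean (b : Bool) (v : M.Store) (s : ∀ k, List (M.S k)) :
    TM2.step M.prog ⟨some (some b), v, M.allStacks [] [] s⟩ =
      if ∀ k, s k = [] then some ⟨none, M.idle M.start, M.allStacks [] [b] fun _ => []⟩
      else some ⟨some (some b), ⟨v.q, v.read, fun k => (s k).head?⟩,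
        M.allStacks [] [] fun k => (s k).tail⟩ := by
  rw [TM2.step, prog, stepAux_popAll _ _ (Finset.nodup_toList _)]
  simp only [mem_toList_univ, if_true, TM2.stepAux, List.head?_eq_none_iff]
  split_ifs with h
  · simp only [h, implies_true, decide_true, cond_true, List.tail_nil]
    rw [update_allStacks_output]
    rfl
  · simp [h]

theorem exists_iterate_clean (b : Bool) (v : M.Store) (m : ℕ) (s : ∀ k, List (M.S k))
    (hs : ∀ k, (s k).length ≤ m) :
    ∃ n ≤ m + 1,
      (flip bind (TM2.step M.prog))^[n] (some ⟨some (some b), v, M.allStacks [] [] s⟩) =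
        some ⟨none, M.idle M.start, M.allStacks [] [b] fun _ => []⟩ := by
  induction m generalizing v s with
  | zero =>
    have hnil : ∀ k, s k = [] := fun k => by simpa using hs k
    exact ⟨1, le_rfl, by simpa [flip, hnil] using M.step_clean b v s⟩
  | succ m ih =>
    have hstep := M.step_clean b v s
    split_ifs at hstep with hnil
    · exact ⟨1, by omega, by simpa [flip] using hstep⟩
    · obtain ⟨n, hn, e⟩ := ih ⟨v.q, v.read, fun k => (s k).head?⟩ (fun k => (s k).tail) fun k => by
        have := hs k
        simp only [List.length_tail]
        omega
      exact ⟨n + 1, by omega, by rw [iterate_succ_apply, ← e]; exact congrArg _ hstep⟩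

theorem exists_iterate_run (x : List A) (q : M.Q) (s : ∀ k, List (M.S k)) (m : ℕ)
    (hs : ∀ k, (s k).length ≤ m) :
    ∃ n ≤ 3 * x.length + m + 2,
      (flip bind (TM2.step M.prog))^[n] (some ⟨some none, M.idle q, M.allStacks x [] s⟩) =
        some ⟨none, M.idle M.start,
          M.allStacks [] [M.acc (M.runFrom (q, s) x).1] fun _ => []⟩ := by
  induction x generalizing q s m with
  | nil =>
    obtain ⟨n, hn, e⟩ := M.exists_iterate_clean (M.acc q) (M.idle q) m s hs
    exact ⟨n + 1, by simp; omega,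
      by rw [iterate_succ_apply]; exact Eq.trans (congrArg _ (M.step_end q s)) e⟩
  | cons a x ih =>
    obtain ⟨n, hn, e⟩ :=
      ih (M.next q a s).1 (M.next q a s).2 (m + 2) (M.length_next_le_add_two q a s m hs)
    exact ⟨n + 1, by simp; omega,
      by rw [iterate_succ_apply]; exact Eq.trans (congrArg _ (M.step_read a x q s)) e⟩

theorem initList_toTM2 [Fintype A] (x : List A) :
    initList M.toTM2 x = ⟨some none, M.idle M.start, M.allStacks x [] fun _ => []⟩ := by
  unfold initList
  congr 1
  funext k
  rcases k with _ | _ | k <;> rfl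

theorem haltList_toTM2 [Fintype A] (b : Bool) :
    haltList M.toTM2 [b] = ⟨none, M.idle M.start, M.allStacks [] [b] fun _ => []⟩ := by
  unfold haltList
  congr 1
  funext k
  rcases k with _ | _ | k <;> rfl

theorem exists_iterate_toTM2 [Fintype A] (x : List A) :
    ∃ n ≤ 3 * x.length + 2, (flip bind M.toTM2.step)^[n] (some (initList M.toTM2 x)) =
      some (haltList M.toTM2 [M.accepts x]) := by
  rw [initList_toTM2, haltList_toTM2]
  exact M.exists_iterate_run x M.start (fun _ => []) 0 fun _ => le_rfl

/-- Acceptance by a stack machine, as a polynomial-time computation on a `TM2` machine. -/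
noncomputable def computableInPolyTime [Fintype A] {β : Type} (enc : β → List A) :
    TM2ComputableInPolyTime enc Computability.encodeBool fun x => M.accepts (enc x) where
  tm := M.toTM2
  inputAlphabet := Equiv.refl A
  outputAlphabet := Equiv.refl Bool
  time := 3 * Polynomial.X + 2
  outputsFun x :=
    have h := M.exists_iterate_toTM2 (enc x)
    have hinput := congrArg (fun l => some (initList M.toTM2 l)) (List.map_id (enc x))
    ⟨⟨h.choose, (congrArg _ hinput).trans h.choose_spec.2⟩, by simpa using h.choose_spec.1⟩

end StackMachine

/-! ### Assembly sequences and plans -/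

namespace Assembly

variable {α : Type}

/-- The word `u` is available after assembly steps with the results `ws`: it is one of them, or a
letter. -/
def Avail (ws : List (List α)) (u : List α) : Prop := u ∈ ws ∨ ∃ a, u = [a]

/-- An assembly sequence: `ws` is the list of the results of some assembly steps. The result of the
last step comes first. -/
inductive Assembled : List (List α) → Prop
  | nil : Assembled []
  | cons {ws : List (List α)} {u v : List α} :
      Assembled ws → Avail ws u → Avail ws v → Assembled ((u ++ v) :: ws)

theorem Avail.cons {ws : List (List α)} {u : List α} (h : Avail ws u) (v : List α) :
    Avail (v :: ws) u :=
  h.imp (List.mem_cons_of_mem _) id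

theorem Avail.singleton (ws : List (List α)) (a : α) : Avail ws [a] := .inr ⟨a, rfl⟩

theorem Assembled.ne_nil_of_avail {ws : List (List α)} (hws : Assembled ws) {u : List α}
    (hu : Avail ws u) : u ≠ [] := by
  induction hws generalizing u with
  | nil =>
    rcases hu with hu | ⟨a, rfl⟩
    · simp at hu
    · simp
  | cons _ hleft _ ih =>
    rcases hu with hu | ⟨a, rfl⟩
    · rcases List.mem_cons.1 hu with rfl | hu
      · simp [ih hleft]
      · exact ih (.inl hu)
    · simp

theorem setOf_avail_cons (ws : List (List α)) (v : List α) :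
    {u | Avail (v :: ws) u} = insert v {u | Avail ws u} := by
  ext u
  simp [Avail, or_assoc]

theorem pool_iff_exists_assembled {t : ℕ} {P : Set (List α)} :
    Pool t P ↔ ∃ ws, Assembled ws ∧ ws.length = t ∧ P = {u | Avail ws u} := by
  constructor
  · intro h
    induction h with
    | init => exact ⟨[], .nil, rfl, by simp [Avail]⟩
    | step _ hu hv ih =>
      obtain ⟨ws, hws, rfl, rfl⟩ := ih
      exact ⟨_, hws.cons hu hv, rfl, (setOf_avail_cons ws _).symm⟩
  · rintro ⟨ws, hws, rfl, rfl⟩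
    induction hws with
    | nil => simpa [Avail] using Pool.init (α := α)
    | cons _ hu hv ih => exact setOf_avail_cons _ _ ▸ ih.step hu hv

theorem asi_le_iff {w : List α} {k : ℕ} :
    asi w ≤ k ↔ ∃ ws, Assembled ws ∧ ws.length ≤ k ∧ Avail ws w := by
  constructor
  · intro h
    have hlt : asi w < ((k + 1 : ℕ) : ℕ∞) := h.trans_lt (by exact_mod_cast Nat.lt_succ_self k)
    simp only [asi, iInf_lt_iff] at hlt
    obtain ⟨t, ⟨P, hP, hw⟩, ht⟩ := hlt
    obtain ⟨ws, hws, rfl, rfl⟩ := pool_iff_exists_assembled.1 hP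
    exact ⟨ws, hws, Nat.lt_succ_iff.1 (by exact_mod_cast ht), hw⟩
  · rintro ⟨ws, hws, hk, hw⟩
    refine (iInf₂_le ws.length ⟨_, pool_iff_exists_assembled.2 ⟨ws, hws, rfl, rfl⟩, hw⟩).trans ?_
    exact_mod_cast hk

theorem exists_assembled_length_add_one_eq {w : List α} (hw : w ≠ []) :
    ∃ ws, Assembled ws ∧ ws.length + 1 = w.length ∧ Avail ws w := by
  induction w with
  | nil => exact absurd rfl hw
  | cons a w ih =>
    rcases eq_or_ne w [] with rfl | h
    · exact ⟨[], .nil, rfl, .singleton _ a⟩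
    · obtain ⟨ws, hws, hlen, hmem⟩ := ih h
      exact ⟨_, hws.cons (.singleton ws a) hmem, by simp [hlen], .inl (by simp)⟩

theorem mem_asiDec_of_length_le {w : List α} {k : ℕ} (hw : w ≠ []) (hk : w.length ≤ k + 1) :
    (w, k) ∈ ASIDec α := by
  obtain ⟨ws, hws, hlen, hmem⟩ := exists_assembled_length_add_one_eq hw
  exact ⟨hw, asi_le_iff.2 ⟨ws, hws, by omega, hmem⟩⟩

theorem Assembled.exists_length_le {ws : List (List α)} (hws : Assembled ws) (n : ℕ) :
    ∃ ws', Assembled ws' ∧ ws'.length ≤ ws.length ∧ (∀ u ∈ ws', u.length ≤ n) ∧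
      ∀ u, Avail ws u → u.length ≤ n → Avail ws' u := by
  induction hws with
  | nil => exact ⟨[], .nil, le_rfl, by simp, fun u hu _ => hu⟩
  | @cons ws u v _ hu hv ih =>
    obtain ⟨ws', hws', hlen, hshort, hkeep⟩ := ih
    by_cases hn : (u ++ v).length ≤ n
    · have huv := hn
      rw [List.length_append] at huv
      refine ⟨_, hws'.cons (hkeep u hu (by omega)) (hkeep v hv (by omega)), by simpa, ?_, ?_⟩
      · simpa using ⟨by simpa using hn, hshort⟩
      · rintro x (hx | hx) hxn
        · rcases List.mem_cons.1 hx with rfl | hx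
          · exact .inl (by simp)
          · exact (hkeep x (.inl hx) hxn).cons _
        · exact .inr hx
    · refine ⟨ws', hws', by simp; omega, hshort, ?_⟩
      rintro x (hx | hx) hxn
      · rcases List.mem_cons.1 hx with rfl | hx
        · exact absurd hxn hn
        · exact hkeep x (.inl hx) hxn
      · exact .inr hx

theorem exists_assembled_of_asi_le {w : List α} {k : ℕ} (hw : w ≠ []) (h : asi w ≤ k) :
    ∃ ws, Assembled ws ∧ ws.length ≤ k ∧ ws.length ≤ w.length ∧ (∀ u ∈ ws, u.length ≤ w.length) ∧
      Avail ws w := by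
  have hmin : asi w ≤ (min k w.length : ℕ) := by
    rw [Nat.mono_cast.map_min]
    exact le_min h (mem_asiDec_of_length_le hw (Nat.le_succ _)).2
  obtain ⟨ws, hws, hlen, hmem⟩ := asi_le_iff.1 hmin
  obtain ⟨ws', hws', hlen', hshort, hkeep⟩ := hws.exists_length_le w.length
  have := le_min_iff.1 hlen
  exact ⟨ws', hws', by omega, by omega, hshort, hkeep w hmem le_rfl⟩

theorem Assembled.exists_cons {ws : List (List α)} (hws : Assembled ws) {w : List α}
    (hw : w ∈ ws) : ∃ ws', Assembled (w :: ws') ∧ (w :: ws').length ≤ ws.length := by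
  induction hws with
  | nil => simp at hw
  | @cons ws u v hws hu hv ih =>
    rcases List.mem_cons.1 hw with rfl | hw
    · exact ⟨ws, hws.cons hu hv, le_rfl⟩
    · obtain ⟨ws', hws', hlen⟩ := ih hw
      exact ⟨ws', hws', hlen.trans (by simp)⟩

theorem Ptr.avail_of_resolve {ws : List (List α)} {p : Ptr α} {u : List α}
    (h : p.resolve ws.reverse = some u) : Avail ws u := by
  cases p with
  | letter a => exact .inr ⟨a, (Option.some.inj h).symm⟩
  | step j => exact .inl (by simpa using List.mem_of_getElem? h)

theorem Avail.exists_resolve {ws : List (List α)} {u : List α} (h : Avail ws u) :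
    ∃ p : Ptr α, p.resolve ws.reverse = some u := by
  rcases h with h | ⟨a, rfl⟩
  · obtain ⟨j, hj⟩ := List.mem_iff_getElem?.1 (List.mem_reverse.2 h)
    exact ⟨.step j, hj⟩
  · exact ⟨.letter a, rfl⟩

theorem Plan.evalFrom_append (xs : List (List α)) (p q : Plan α) :
    Plan.evalFrom xs (p ++ q) = (Plan.evalFrom xs p).bind fun ys => Plan.evalFrom ys q := by
  induction p generalizing xs with
  | nil => rfl
  | cons x p ih =>
    obtain ⟨a, b⟩ := x
    simp only [List.cons_append, Plan.evalFrom]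
    cases a.resolve xs <;> cases b.resolve xs <;> simp [ih]

theorem Assembled.exists_plan {ws : List (List α)} (hws : Assembled ws) :
    ∃ p : Plan α, p.length = ws.length ∧ Plan.evalFrom [] p = some ws.reverse := by
  induction hws with
  | nil => exact ⟨[], rfl, rfl⟩
  | @cons ws u v _ hu hv ih =>
    obtain ⟨p, hlen, heval⟩ := ih
    obtain ⟨a, ha⟩ := hu.exists_resolve
    obtain ⟨b, hb⟩ := hv.exists_resolve
    refine ⟨p ++ [(a, b)], by simp [hlen], ?_⟩
    rw [Plan.evalFrom_append, heval]
    simp [Plan.evalFrom, ha, hb]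

theorem Assembled.of_evalFrom {ws : List (List α)} (hws : Assembled ws) {p : Plan α}
    {xs : List (List α)} (heval : Plan.evalFrom ws.reverse p = some xs) :
    Assembled xs.reverse ∧ xs.length = ws.length + p.length := by
  induction p generalizing ws with
  | nil =>
    obtain rfl := Option.some.inj heval
    simpa using hws
  | cons x p ih =>
    obtain ⟨a, b⟩ := x
    rw [Plan.evalFrom] at heval
    split at heval
    · rename_i u v hu hv
      obtain ⟨hxs, hlen⟩ :=
        ih (hws.cons (Ptr.avail_of_resolve hu) (Ptr.avail_of_resolve hv)) (by simpa using heval)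
      exact ⟨hxs, by simp [hlen]; omega⟩
    · simp at heval

theorem mem_asiDec_iff_exists_plan {w : List α} {k : ℕ} (hw : 2 ≤ w.length) :
    (w, k) ∈ ASIDec α ↔ ∃ p : Plan α, p.length ≤ k ∧ p.Builds w := by
  constructor
  · rintro ⟨-, h⟩
    obtain ⟨ws, hws, hlen, hmem | ⟨a, rfl⟩⟩ := asi_le_iff.1 h
    · obtain ⟨ws', hws', hlen'⟩ := hws.exists_cons hmem
      obtain ⟨p, hp, heval⟩ := hws'.exists_plan
      exact ⟨p, by omega, _, heval, by simp⟩
    · simp at hw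
  · rintro ⟨p, hp, xs, heval, hlast⟩
    obtain ⟨hxs, hlen⟩ := Assembled.nil.of_evalFrom (p := p) (xs := xs) heval
    have hne : w ≠ [] := List.ne_nil_of_length_pos (by omega)
    refine ⟨hne, asi_le_iff.2 ⟨_, hxs, ?_, .inl ?_⟩⟩
    · simpa [hlen] using hp
    · simpa using List.mem_of_getLast? hlast

/-! ### Membership in NP -/

namespace Verifier

/-- The commands that make up a certificate. They move the digits of a counter (`lower`, `raise`),
take units from it (`take`, `give`), move a head on a tape that holds the words assembled so far
(`left`, `right`), collect a new word (`letter`, `beginCopy`, `copy`, `endCopy`), write it on the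
tape (`insert`, `put`, `finish`), and compare it with `w` (`compare`, `check`, `accept`). -/
inductive Cmd (α : Type) : Type
  | start
  | lower | raise | take | give
  | left | right
  | letter (a : α)
  | beginCopy | copy | endCopy
  | insert | put | finish
  | compare | check | accept
  deriving Fintype

/-- The phases of the verifier: reading `w`, reading `k` (`num b` after the digit `b`), choosing
what to do next, copying a word from the tape, writing a word on the tape, comparing with `w`,
accepting, and rejecting. -/
inductive Mode : Type
  | word | num (b : Bool) | free | copying | writing | comparing | done | dead
  deriving Fintype

/-- The configurations of the verifier. A counter has the lower digits `A` and the higher digits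
`B`, both with the digits nearest to the boundary first, and one more unit at the lowest position of
`B` if `held` is `true`. The tape holds the assembled words, each preceded by `none`; `L` is the
part to the left of the head, reversed, and `R` the part to the right. `N` is the new word,
reversed, and `W` the word `w`, reversed. -/
structure Conf (α : Type) : Type where
  /-- the phase -/
  mode : Mode
  /-- whether a unit has been taken from the counter -/
  held : Bool
  /-- the lower digits of the counter -/
  A : List Bool
  /-- the higher digits of the counter -/
  B : List Bool
  /-- the tape to the left of the head, reversed -/
  L : List (Option α)
  /-- the tape to the right of the head -/
  R : List (Option α)
  /-- the new word, reversed -/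
  N : List α
  /-- the word `w`, reversed -/
  W : List α

/-- The head of the tape is not inside a word, if `R` is the part of the tape to its right. -/
def atBoundary : List (Option α) → Bool
  | some _ :: _ => false
  | _ => true

open Classical in
/-- The execution of a command; commands that are not applicable are ignored. -/
noncomputable def exec (c : Conf α) : Cmd α → Conf α
  | .start =>
    match c.mode with
    | .word | .num true => { c with mode := .free }
    | _ => c
  | .lower =>
    match c.A with
    | d :: A => { c with A := A, B := d :: c.B }
    | _ => c
  | .raise =>
    match c.held, c.B with
    | false, d :: B => { c with A := d :: c.A, B := B }
    | _, _ => c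
  | .take =>
    match c.held, c.B with
    | false, true :: B => { c with held := true, B := false :: B }
    | _, _ => c
  -- the held unit is worth two units at the next lower position, one of which stays held
  | .give =>
    match c.held, c.A with
    | true, false :: A => { c with A := A, B := true :: c.B }
    | _, _ => c
  | .left =>
    match c.mode, c.L with
    | .free, x :: L => { c with L := L, R := x :: c.R }
    | _, _ => c
  | .right =>
    match c.mode, c.R with
    | .free, x :: R => { c with L := x :: c.L, R := R }
    | _, _ => c
  -- extending a nonempty new word is an assembly step, paid for with the held unit
  | .letter a =>
    match c.mode, c.held || c.N.isEmpty with
    | .free, true => { c with held := c.held && c.N.isEmpty, N := a :: c.N }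
    | _, _ => c
  | .beginCopy =>
    match c.mode, c.held || c.N.isEmpty, c.R with
    | .free, true, none :: R =>
      { c with mode := .copying, held := c.held && c.N.isEmpty, L := none :: c.L, R := R }
    | _, _, _ => c
  | .copy =>
    match c.mode, c.R with
    | .copying, some a :: R => { c with L := some a :: c.L, R := R, N := a :: c.N }
    | _, _ => c
  | .endCopy =>
    match c.mode, atBoundary c.R with
    | .copying, true => { c with mode := .free }
    | _, _ => c
  | .insert =>
    match c.mode, c.L, atBoundary c.R with
    | .free, [], true => { c with mode := .writing }
    | _, _, _ => c
  | .put =>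
    match c.mode, c.N with
    | .writing, a :: N => { c with R := some a :: c.R, N := N }
    | _, _ => c
  | .finish =>
    match c.mode, c.N with
    | .writing, [] => { c with mode := .free, R := none :: c.R }
    | _, _ => c
  | .compare =>
    match c.mode, c.N with
    | .free, _ :: _ => { c with mode := .comparing }
    | _, _ => c
  | .check =>
    match c.mode, c.N, c.W with
    | .comparing, a :: N, b :: W => if a = b then { c with N := N, W := W } else c
    | _, _, _ => c
  | .accept =>
    match c.mode, c.N, c.W with
    | .comparing, [], [] => { c with mode := .done }
    | _, _, _ => c

/-- The reaction to an input symbol: a letter of `w`, a digit of `k`, or a command. -/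
noncomputable def step (c : Conf α) : (α ⊕ Bool) ⊕ Cmd α → Conf α
  | .inl (.inl a) =>
    match c.mode with
    | .word => { c with W := a :: c.W }
    | _ => { c with mode := .dead }
  | .inl (.inr b) =>
    match c.mode with
    | .word | .num _ => { c with mode := .num b, A := b :: c.A }
    | _ => { c with mode := .dead }
  | .inr x => exec c x

/-- The initial configuration of the verifier. -/
def initial : Conf α := ⟨.word, false, [], [], [], [], [], []⟩

/-- The configuration with only the top symbols of the stacks. -/
def Conf.top (c : Conf α) : Conf α :=
  ⟨c.mode, c.held, c.A.take 1, c.B.take 1, c.L.take 1, c.R.take 1, c.N.take 1, c.W.take 1⟩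

/-- `c` on top of what is below the top symbols in `d`. -/
def Conf.over (c d : Conf α) : Conf α :=
  ⟨c.mode, c.held, c.A ++ d.A.drop 1, c.B ++ d.B.drop 1, c.L ++ d.L.drop 1, c.R ++ d.R.drop 1,
    c.N ++ d.N.drop 1, c.W ++ d.W.drop 1⟩

theorem exec_top_over (c : Conf α) (x : Cmd α) : (exec c.top x).over c = exec c x := by
  have take_append_tail {β : Type} (l : List β) : l.take 1 ++ l.tail = l := by cases l <;> simp
  obtain ⟨m, h, A, B, L, R, N, W⟩ := c
  cases x with
  | start => rcases m with _ | ⟨_ | _⟩ | _ <;> simp [exec, Conf.top, Conf.over, take_append_tail]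
  | lower => cases A <;> simp [exec, Conf.top, Conf.over, take_append_tail]
  | raise => cases h <;> cases B <;> simp [exec, Conf.top, Conf.over, take_append_tail]
  | take =>
    cases h <;> rcases B with _ | ⟨_ | _, _⟩ <;> simp [exec, Conf.top, Conf.over, take_append_tail]
  | give =>
    cases h <;> rcases A with _ | ⟨_ | _, _⟩ <;> simp [exec, Conf.top, Conf.over, take_append_tail]
  | left => cases m <;> cases L <;> simp [exec, Conf.top, Conf.over, take_append_tail]
  | right => cases m <;> cases R <;> simp [exec, Conf.top, Conf.over, take_append_tail]
  | letter a =>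
    cases m <;> cases h <;> cases N <;> simp [exec, Conf.top, Conf.over, take_append_tail]
  | beginCopy =>
    cases m <;> cases h <;> cases N <;> rcases R with _ | ⟨_ | _, _⟩ <;>
      simp [exec, Conf.top, Conf.over, take_append_tail]
  | copy =>
    cases m <;> rcases R with _ | ⟨_ | _, _⟩ <;> simp [exec, Conf.top, Conf.over, take_append_tail]
  | endCopy =>
    cases m <;> rcases R with _ | ⟨_ | _, _⟩ <;>
      simp [exec, Conf.top, Conf.over, take_append_tail, atBoundary]
  | insert =>
    cases m <;> cases L <;> rcases R with _ | ⟨_ | _, _⟩ <;>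
      simp [exec, Conf.top, Conf.over, take_append_tail, atBoundary]
  | put | finish | compare =>
    cases m <;> cases N <;> simp [exec, Conf.top, Conf.over, take_append_tail]
  | check =>
    cases m <;> cases N <;> cases W <;> simp [exec, Conf.top, Conf.over, take_append_tail]
    split_ifs <;> simp [take_append_tail]
  | accept =>
    cases m <;> cases N <;> cases W <;> simp [exec, Conf.top, Conf.over, take_append_tail]

theorem step_top_over (c : Conf α) (x : (α ⊕ Bool) ⊕ Cmd α) :
    (step c.top x).over c = step c x := by
  have take_append_tail {β : Type} (l : List β) : l.take 1 ++ l.tail = l := by cases l <;> simp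
  rcases x with (a | b) | x
  · cases hm : c.mode <;> simp [step, Conf.top, Conf.over, take_append_tail, hm]
  · cases hm : c.mode <;> simp [step, Conf.top, Conf.over, take_append_tail, hm]
  · exact exec_top_over c x

/-- The names of the stacks of the verifier. -/
inductive Stack : Type
  | A | B | L | R | N | W
  deriving DecidableEq

instance : Fintype Stack :=
  ⟨{.A, .B, .L, .R, .N, .W}, fun k => by cases k <;> decide⟩

/-- The stack alphabets of the verifier. -/
abbrev Stack.Symbol (α : Type) : Stack → Type
  | A | B => Bool
  | L | R => Option α
  | N | W => α

/-- The stacks of a configuration. -/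
def Conf.stack (c : Conf α) : ∀ k : Stack, List (k.Symbol α)
  | .A => c.A
  | .B => c.B
  | .L => c.L
  | .R => c.R
  | .N => c.N
  | .W => c.W

/-- The configuration with the given mode, `held` flag and stacks. -/
abbrev ofStack (q : Mode × Bool) (s : ∀ k : Stack, List (k.Symbol α)) : Conf α :=
  ⟨q.1, q.2, s .A, s .B, s .L, s .R, s .N, s .W⟩

theorem length_stack_exec_le (c : Conf α) (x : Cmd α) (k : Stack) :
    ((exec c x).stack k).length ≤ (c.stack k).length + 1 := by
  cases x <;> simp only [exec] <;> (repeat' split) <;> cases k <;>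
    simp only [Conf.stack, List.length_cons, *] <;> omega

theorem length_stack_step_le (c : Conf α) (x : (α ⊕ Bool) ⊕ Cmd α) (k : Stack) :
    ((step c x).stack k).length ≤ (c.stack k).length + 1 := by
  rcases x with (a | b) | x
  · simp only [step]
    split <;> cases k <;> simp [Conf.stack]
  · simp only [step]
    split <;> cases k <;> simp [Conf.stack]
  · exact length_stack_exec_le c x k

/-- The verifier as a stack machine. -/
noncomputable def machine (α : Type) [Fintype α] : StackMachine ((α ⊕ Bool) ⊕ Cmd α) where
  Q := Mode × Bool
  K := Stack
  S := Stack.Symbol α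
  finS k := by cases k <;> infer_instance
  start := (.word, false)
  next q x s :=
    (((step (ofStack q s) x).mode, (step (ofStack q s) x).held), (step (ofStack q s) x).stack)
  acc q :=
    match q.1 with
    | .done => true
    | _ => false
  next_eq q a s := by
    have hlocal := step_top_over (ofStack q s) a
    refine Prod.ext (Prod.ext (congrArg Conf.mode hlocal).symm (congrArg Conf.held hlocal).symm)
      ((congrArg Conf.stack hlocal).symm.trans ?_)
    funext k
    cases k <;> rfl
  length_next_le q a s hs k := by
    have hk : ((ofStack q s).stack k).length ≤ 1 := by cases k <;> exact hs _
    exact (length_stack_step_le (ofStack q s) a k).trans (by omega)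

theorem runFrom_machine [Fintype α] (c : Conf α) (x : List ((α ⊕ Bool) ⊕ Cmd α)) :
    (machine α).runFrom ((c.mode, c.held), c.stack) x =
      (((x.foldl step c).mode, (x.foldl step c).held), (x.foldl step c).stack) := by
  induction x generalizing c with
  | nil => rfl
  | cons a _ ih => exact ih (step c a)

theorem accepts_machine_iff [Fintype α] (x : List ((α ⊕ Bool) ⊕ Cmd α)) :
    (machine α).accepts x = true ↔ (x.foldl step initial).mode = .done := by
  have hstart : ((machine α).start, fun _ => []) =
      (((initial : Conf α).mode, (initial : Conf α).held), (initial : Conf α).stack) := by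
    refine Prod.ext rfl ?_
    funext k
    cases k <;> rfl
  have hrun : (machine α).accepts x =
      (machine α).acc ((x.foldl step initial).mode, (x.foldl step initial).held) :=
    (congrArg (fun c => (machine α).acc ((machine α).runFrom c x).1) hstart).trans
      (congrArg (fun c => (machine α).acc c.1) (runFrom_machine initial x))
  rw [hrun]
  cases (x.foldl step (initial : Conf α)).mode <;> simp [machine]


/-- The number with the binary digits `l`, least significant digit first. -/
def num (l : List Bool) : ℕ := l.foldr Nat.bit 0

/-- The number of units on the counter of a configuration. -/
def total (held : Bool) (A B : List Bool) : ℕ :=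
  A.foldl (fun v b => Nat.bit b v) (num B + held.toNat)

theorem num_bits (k : ℕ) : num k.bits = k := by
  induction k using Nat.binaryRec' with
  | zero => simp [num]
  | bit b n h ih => rw [Nat.bits_append_bit _ _ h, num, List.foldr_cons, ← num, ih]

theorem bits_num {l : List Bool} (hl : l.getLast? ≠ some false) : (num l).bits = l := by
  induction l with
  | nil => simp [num]
  | cons b l ih =>
    rcases l with _ | ⟨d, l⟩
    · cases b
      · simp at hl
      · simp [num]
    · have ih' := ih (by simpa using hl)
      rw [num, List.foldr_cons, ← num, Nat.bits_append_bit, ih']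
      intro h0
      simp [h0] at ih'

theorem total_false_reverse (l : List Bool) : total false l.reverse [] = num l := by
  simp [total, num, List.foldl_reverse]

theorem strictMono_foldl_bit (A : List Bool) :
    StrictMono fun v => A.foldl (fun v b => Nat.bit b v) v := by
  induction A with
  | nil => exact strictMono_id
  | cons b _ ih =>
    intro v v' h
    exact ih (by simp only [Nat.bit_val]; omega)

theorem total_false_lt_total_true (A B : List Bool) : total false A B < total true A B :=
  strictMono_foldl_bit A (by simp)

/-- The word `u` is empty or available. -/
def NilOrAvail (ws : List (List α)) (u : List α) : Prop := u = [] ∨ Avail ws u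

/-- All words on the tape `T` are empty or available. -/
def OnTape (ws : List (List α)) (T : List (Option α)) : Prop :=
  ∀ X u Y, T = X ++ none :: (u.map some ++ Y) → atBoundary Y → NilOrAvail ws u

theorem NilOrAvail.append {ws : List (List α)} {u v : List α} {n : ℕ} (hws : Assembled ws)
    (hu : u = [] ∨ Avail ws u ∧ 1 ≤ n) (hv : NilOrAvail ws v) :
    ∃ ws', Assembled ws' ∧ ws'.length ≤ ws.length + n ∧ NilOrAvail ws' (u ++ v) ∧
      ∀ x, NilOrAvail ws x → NilOrAvail ws' x := by
  rcases hu with rfl | ⟨hu, hn⟩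
  · exact ⟨ws, hws, by omega, hv, fun _ => id⟩
  rcases hv with rfl | hv
  · exact ⟨ws, hws, by omega, .inr (by simpa using hu), fun _ => id⟩
  · exact ⟨_, hws.cons hu hv, by simpa using hn, .inr (.inl (by simp)),
      fun x hx => hx.imp id fun h => h.cons _⟩

theorem OnTape.nil (ws : List (List α)) : OnTape ws [] := fun X u Y h => by simp at h

theorem OnTape.mono {ws ws' : List (List α)} {T : List (Option α)} (hT : OnTape ws T)
    (h : ∀ x, NilOrAvail ws x → NilOrAvail ws' x) : OnTape ws' T :=
  fun X u Y hX hY => h u (hT X u Y hX hY)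

theorem eq_of_map_some_append_eq {u v : List α} {Y Z : List (Option α)} (hY : atBoundary Y)
    (hZ : atBoundary Z) (h : u.map some ++ Y = v.map some ++ Z) : u = v := by
  induction u generalizing v with
  | nil =>
    rcases v with _ | ⟨b, v⟩
    · rfl
    · obtain rfl : Y = _ := h
      simp [atBoundary] at hY
  | cons a u ih =>
    rcases v with _ | ⟨b, v⟩
    · obtain rfl : _ = Z := h
      simp [atBoundary] at hZ
    · simp only [List.map_cons, List.cons_append, List.cons.injEq, Option.some.injEq] at h
      rw [h.1, ih h.2]

theorem OnTape.cons {ws : List (List α)} {T : List (Option α)} (hT : OnTape ws T)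
    (hb : atBoundary T) {v : List α} (hv : NilOrAvail ws v) :
    OnTape ws (none :: (v.map some ++ T)) := by
  intro X u Y h hY
  rcases X with _ | ⟨x, X⟩
  · obtain rfl := eq_of_map_some_append_eq hb hY (List.cons.inj h).2
    exact hv
  · rcases List.append_eq_append_iff.1 (List.cons.inj h).2 with ⟨Z, rfl, hZ⟩ | ⟨Z, hX, hZ⟩
    · exact hT Z u Y hZ hY
    · rcases Z with _ | ⟨z, Z⟩
      · exact hT [] u Y hZ.symm hY
      · have hmem : none ∈ v.map some := by
          rw [hX, (List.cons.inj hZ).1]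
          simp
        simp at hmem

/-- What is true of the contents of the tape, the new word and `w` after the assembly steps `ws`. A
word `u ++ p` with a nonempty `u` that is being collected while `p` is copied owes an assembly
step. -/
def Valid (w : List α) (ws : List (List α)) (debt : ℕ) (c : Conf α) : Prop :=
  match c.mode with
  | .word | .num true | .free =>
    OnTape ws (c.L.reverse ++ c.R) ∧ NilOrAvail ws c.N.reverse ∧ c.W.reverse = w
  | .copying =>
    OnTape ws (c.L.reverse ++ c.R) ∧
      (∃ u p L, c.N.reverse = u ++ p ∧ (u = [] ∨ Avail ws u ∧ 1 ≤ debt) ∧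
        c.L.reverse = L ++ none :: p.map some) ∧
      c.W.reverse = w
  | .writing =>
    c.L = [] ∧
      (∃ q T, c.R = q.map some ++ T ∧ atBoundary T ∧ OnTape ws T ∧
        NilOrAvail ws (c.N.reverse ++ q)) ∧
      c.W.reverse = w
  | .comparing => ∃ s, Avail ws (c.N.reverse ++ s) ∧ c.W.reverse ++ s = w
  | .done => Avail ws w
  | .num false | .dead => False

/-- The invariant of the verifier for the input `(w, k)`: together with the units on the counter,
the assembly steps so far do not exceed `k`. -/
def Invariant (w : List α) (k : ℕ) (c : Conf α) : Prop :=
  ∃ ws debt, Assembled ws ∧ ws.length + debt + total c.held c.A c.B ≤ k ∧ Valid w ws debt c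

section Invariant

variable {w : List α} {k : ℕ} {c : Conf α}

theorem Invariant.of_total_le (h : Invariant w k c) {held : Bool} {A B : List Bool}
    (hle : total held A B ≤ total c.held c.A c.B) :
    Invariant w k { c with held := held, A := A, B := B } := by
  obtain ⟨ws, debt, hws, hk, hv⟩ := h
  exact ⟨ws, debt, hws, (Nat.add_le_add_left hle _).trans hk, hv⟩

theorem Invariant.exec_start (h : Invariant w k c) : Invariant w k (exec c .start) := by
  obtain ⟨ws, debt, hws, hk, hv⟩ := h
  obtain ⟨m, held, A, B, L, R, N, W⟩ := c
  simp only [exec]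
  split <;> exact ⟨ws, debt, hws, hk, hv⟩

theorem Invariant.exec_lower (h : Invariant w k c) : Invariant w k (exec c .lower) := by
  obtain ⟨m, held, A, B, L, R, N, W⟩ := c
  simp only [exec]
  split
  · refine h.of_total_le ((strictMono_foldl_bit _).monotone ?_)
    simp only [num, List.foldr_cons, Nat.bit_val]
    omega
  · exact h

theorem Invariant.exec_raise (h : Invariant w k c) : Invariant w k (exec c .raise) := by
  obtain ⟨m, held, A, B, L, R, N, W⟩ := c
  simp only [exec]
  split
  · exact h.of_total_le le_rfl
  · exact h

theorem Invariant.exec_take (h : Invariant w k c) : Invariant w k (exec c .take) := by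
  obtain ⟨m, held, A, B, L, R, N, W⟩ := c
  simp only [exec]
  split
  · exact h.of_total_le ((strictMono_foldl_bit _).monotone (by simp [num, Nat.bit_val]))
  · exact h

theorem Invariant.exec_give (h : Invariant w k c) : Invariant w k (exec c .give) := by
  obtain ⟨m, held, A, B, L, R, N, W⟩ := c
  simp only [exec]
  split
  · refine h.of_total_le ((strictMono_foldl_bit _).monotone ?_)
    simp only [num, List.foldr_cons, Nat.bit_val, Bool.toNat_true, Bool.toNat_false]
    omega
  · exact h

theorem Invariant.exec_left (h : Invariant w k c) : Invariant w k (exec c .left) := by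
  obtain ⟨ws, debt, hws, hk, hv⟩ := h
  obtain ⟨m, held, A, B, L, R, N, W⟩ := c
  simp only [exec]
  split
  · exact ⟨ws, debt, hws, hk, by simpa [Valid] using hv⟩
  · exact ⟨ws, debt, hws, hk, hv⟩

theorem Invariant.exec_right (h : Invariant w k c) : Invariant w k (exec c .right) := by
  obtain ⟨ws, debt, hws, hk, hv⟩ := h
  obtain ⟨m, held, A, B, L, R, N, W⟩ := c
  simp only [exec]
  split
  · exact ⟨ws, debt, hws, hk, by simpa [Valid] using hv⟩
  · exact ⟨ws, debt, hws, hk, hv⟩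

theorem Invariant.exec_letter (h : Invariant w k c) (a : α) :
    Invariant w k (exec c (.letter a)) := by
  obtain ⟨ws, debt, hws, hk, hv⟩ := h
  obtain ⟨m, held, A, B, L, R, N, W⟩ := c
  simp only [exec]
  split
  · rename_i hpaid
    obtain ⟨hT, hN, hW⟩ := hv
    rcases N with _ | ⟨b, N⟩
    · exact ⟨ws, debt, hws, by simpa using hk, hT, .inr (.singleton ws a), hW⟩
    · obtain rfl : held = true := by simpa using hpaid
      obtain ⟨ws', hws', hlen, hNa, hmono⟩ :=
        NilOrAvail.append (n := 1) hws (hN.imp id fun h => ⟨h, le_rfl⟩) (.inr (.singleton ws a))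
      refine ⟨ws', debt, hws', ?_, hT.mono hmono, by simpa using hNa, hW⟩
      have hlt := total_false_lt_total_true A B
      simp only [List.isEmpty_cons, Bool.and_false] at hk ⊢
      omega
  · exact ⟨ws, debt, hws, hk, hv⟩

theorem Invariant.exec_beginCopy (h : Invariant w k c) : Invariant w k (exec c .beginCopy) := by
  obtain ⟨ws, debt, hws, hk, hv⟩ := h
  obtain ⟨m, held, A, B, L, R, N, W⟩ := c
  simp only [exec]
  split
  · rename_i hpaid
    obtain ⟨hT, hN, hW⟩ := hv
    rcases N with _ | ⟨b, N⟩
    · exact ⟨ws, debt, hws, by simpa using hk, by simpa using hT,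
        ⟨[], [], L.reverse, by simp, .inl rfl, by simp⟩, hW⟩
    · obtain rfl : held = true := by simpa using hpaid
      refine ⟨ws, debt + 1, hws, ?_, by simpa using hT,
        ⟨_, [], L.reverse, (List.append_nil _).symm, hN.imp id fun h => ⟨h, by omega⟩, by simp⟩,
        hW⟩
      have hlt := total_false_lt_total_true A B
      simp only [List.isEmpty_cons, Bool.and_false] at hk ⊢
      omega
  · exact ⟨ws, debt, hws, hk, hv⟩

theorem Invariant.exec_copy (h : Invariant w k c) : Invariant w k (exec c .copy) := by
  obtain ⟨ws, debt, hws, hk, hv⟩ := h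
  obtain ⟨m, held, A, B, L, R, N, W⟩ := c
  simp only [exec]
  split
  · rename_i a R
    obtain ⟨hT, ⟨u, p, L', hN, hu, hL⟩, hW⟩ := hv
    refine ⟨ws, debt, hws, hk, by simpa using hT, ⟨u, p ++ [a], L', ?_, hu, ?_⟩, hW⟩
    · rw [List.reverse_cons, hN, List.append_assoc]
    · rw [List.reverse_cons, hL]
      simp
  · exact ⟨ws, debt, hws, hk, hv⟩

theorem Invariant.exec_endCopy (h : Invariant w k c) : Invariant w k (exec c .endCopy) := by
  obtain ⟨ws, debt, hws, hk, hv⟩ := h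
  obtain ⟨m, held, A, B, L, R, N, W⟩ := c
  simp only [exec]
  split
  · rename_i hb
    obtain ⟨hT, ⟨u, p, L', hN, hu, hL⟩, hW⟩ := hv
    have hp : NilOrAvail ws p := hT L' p R (by simp_all) hb
    obtain ⟨ws', hws', hlen, hup, hmono⟩ := hp.append hws hu
    exact ⟨ws', 0, hws', by simp only at hk ⊢; omega, hT.mono hmono, by simpa [hN] using hup, hW⟩
  · exact ⟨ws, debt, hws, hk, hv⟩

theorem Invariant.exec_insert (h : Invariant w k c) : Invariant w k (exec c .insert) := by
  obtain ⟨ws, debt, hws, hk, hv⟩ := h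
  obtain ⟨m, held, A, B, L, R, N, W⟩ := c
  simp only [exec]
  split
  · rename_i hb
    obtain ⟨hT, hN, hW⟩ := hv
    exact ⟨ws, debt, hws, hk, rfl, ⟨[], R, rfl, hb, hT, by simpa using hN⟩, hW⟩
  · exact ⟨ws, debt, hws, hk, hv⟩

theorem Invariant.exec_put (h : Invariant w k c) : Invariant w k (exec c .put) := by
  obtain ⟨ws, debt, hws, hk, hv⟩ := h
  obtain ⟨m, held, A, B, L, R, N, W⟩ := c
  simp only [exec]
  split
  · rename_i a N
    obtain ⟨hL, ⟨q, T, rfl, hb, hT, hN⟩, hW⟩ := hv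
    exact ⟨ws, debt, hws, hk, hL, ⟨a :: q, T, rfl, hb, hT, by simpa using hN⟩, hW⟩
  · exact ⟨ws, debt, hws, hk, hv⟩

theorem Invariant.exec_finish (h : Invariant w k c) : Invariant w k (exec c .finish) := by
  obtain ⟨ws, debt, hws, hk, hv⟩ := h
  obtain ⟨m, held, A, B, L, R, N, W⟩ := c
  simp only [exec]
  split
  · obtain ⟨rfl, ⟨q, T, rfl, hb, hT, hN⟩, hW⟩ := hv
    exact ⟨ws, debt, hws, hk, hT.cons hb hN, .inl rfl, hW⟩
  · exact ⟨ws, debt, hws, hk, hv⟩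

theorem Invariant.exec_compare (h : Invariant w k c) : Invariant w k (exec c .compare) := by
  obtain ⟨ws, debt, hws, hk, hv⟩ := h
  obtain ⟨m, held, A, B, L, R, N, W⟩ := c
  simp only [exec]
  split
  · obtain ⟨-, hN, hW⟩ := hv
    exact ⟨ws, debt, hws, hk, [], by simpa using hN.resolve_left (by simp), by simpa using hW⟩
  · exact ⟨ws, debt, hws, hk, hv⟩

theorem Invariant.exec_check (h : Invariant w k c) : Invariant w k (exec c .check) := by
  obtain ⟨ws, debt, hws, hk, hv⟩ := h
  obtain ⟨m, held, A, B, L, R, N, W⟩ := c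
  simp only [exec]
  split
  · split_ifs with hab
    · subst hab
      obtain ⟨s, hN, hW⟩ := hv
      exact ⟨ws, debt, hws, hk, _ :: s, by simpa using hN, by simpa using hW⟩
    · exact ⟨ws, debt, hws, hk, hv⟩
  · exact ⟨ws, debt, hws, hk, hv⟩

theorem Invariant.exec_accept (h : Invariant w k c) : Invariant w k (exec c .accept) := by
  obtain ⟨ws, debt, hws, hk, hv⟩ := h
  obtain ⟨m, held, A, B, L, R, N, W⟩ := c
  simp only [exec]
  split
  · obtain ⟨s, hN, rfl⟩ := hv
    exact ⟨ws, debt, hws, hk, hN⟩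
  · exact ⟨ws, debt, hws, hk, hv⟩

theorem Invariant.exec (h : Invariant w k c) (x : Cmd α) : Invariant w k (exec c x) :=
  match x with
  | .start => h.exec_start
  | .lower => h.exec_lower
  | .raise => h.exec_raise
  | .take => h.exec_take
  | .give => h.exec_give
  | .left => h.exec_left
  | .right => h.exec_right
  | .letter a => h.exec_letter a
  | .beginCopy => h.exec_beginCopy
  | .copy => h.exec_copy
  | .endCopy => h.exec_endCopy
  | .insert => h.exec_insert
  | .put => h.exec_put
  | .finish => h.exec_finish
  | .compare => h.exec_compare
  | .check => h.exec_check
  | .accept => h.exec_accept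

theorem Invariant.foldl_exec (h : Invariant w k c) (y : List (Cmd α)) :
    Invariant w k (y.foldl Verifier.exec c) := by
  induction y generalizing c with
  | nil => exact h
  | cons x _ ih => exact ih (h.exec x)

end Invariant

/-- The configuration after reading the letters of `w` and the digits `bs`. -/
def afterReading (w : List α) (bs : List Bool) : Conf α :=
  ⟨match bs.getLast? with
    | none => .word
    | some b => .num b, false, bs.reverse, [], [], [], [], w.reverse⟩

theorem foldl_step_letters_digits (w : List α) (bs : List Bool) :
    (w.map Sum.inl ++ bs.map Sum.inr).foldl (fun c a => step c (.inl a)) initial =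
      afterReading w bs := by
  induction bs using List.reverseRecOn with
  | nil =>
    induction w using List.reverseRecOn with
    | nil => rfl
    | append_singleton w a ih =>
      simp only [List.map_nil, List.append_nil] at ih ⊢
      rw [List.map_append, List.foldl_append, ih]
      simp [step, afterReading]
  | append_singleton bs b ih =>
    rw [List.map_append, ← List.append_assoc, List.foldl_append, ih]
    rcases hb : bs.getLast? with _ | d <;> simp [step, afterReading, hb]

theorem eq_letters_digits_or_mode_eq_dead (x : List (α ⊕ Bool)) :
    (∃ (w : List α) (bs : List Bool), x = w.map Sum.inl ++ bs.map Sum.inr) ∨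
      (x.foldl (fun c a => step c (.inl a)) initial).mode = .dead := by
  induction x using List.reverseRecOn with
  | nil => exact .inl ⟨[], [], rfl⟩
  | append_singleton x a ih =>
    rw [List.foldl_append]
    rcases ih with ⟨w, bs, rfl⟩ | h
    · rcases a with a | b
      · rcases bs.eq_nil_or_concat with rfl | ⟨bs, b, rfl⟩
        · exact .inl ⟨w ++ [a], [], by simp⟩
        · right
          rw [foldl_step_letters_digits]
          simp [step, afterReading]
      · exact .inl ⟨w, bs ++ [b], by simp⟩
    · right
      generalize x.foldl (fun c a => step c (.inl a)) (initial : Conf α) = c at h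
      rcases a with a | b <;> simp [step, h]

theorem mode_foldl_exec_of_stuck {c : Conf α} (hc : c.mode = .dead ∨ c.mode = .num false)
    (y : List (Cmd α)) : (y.foldl exec c).mode = c.mode := by
  induction y generalizing c with
  | nil => rfl
  | cons x y ih =>
    have hx : (exec c x).mode = c.mode := by
      rcases hc with hc | hc <;> cases x <;> simp only [exec, hc] <;> split <;> simp_all
    rw [List.foldl_cons, ih (by rwa [hx]), hx]

theorem invariant_afterReading (w : List α) {bs : List Bool} (hbs : bs.getLast? ≠ some false) :
    Invariant w (num bs) (afterReading w bs) := by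
  refine ⟨[], 0, .nil, by simp [afterReading, total_false_reverse], ?_⟩
  have hvalid : OnTape [] ([] : List (Option α)) ∧ NilOrAvail [] ([] : List α) ∧
      w.reverse.reverse = w := ⟨.nil _, .inl rfl, by simp⟩
  rcases hb : bs.getLast? with _ | _ | _
  · simpa [Valid, afterReading, hb] using hvalid
  · exact absurd hb hbs
  · simpa [Valid, afterReading, hb] using hvalid

theorem mem_asiDecLanguage_of_mode_eq_done {x : List (α ⊕ Bool)} {y : List (Cmd α)}
    (h : (y.foldl exec (x.foldl (fun c a => step c (.inl a)) initial)).mode = .done) :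
    x ∈ asiDecLanguage α := by
  rcases eq_letters_digits_or_mode_eq_dead x with ⟨w, bs, rfl⟩ | hdead
  · rw [foldl_step_letters_digits] at h
    have hbs : bs.getLast? ≠ some false := by
      intro hbs
      rw [mode_foldl_exec_of_stuck (.inr (by simp [afterReading, hbs]))] at h
      simp [afterReading, hbs] at h
    obtain ⟨ws, debt, hws, hk, hv⟩ := (invariant_afterReading w hbs).foldl_exec y
    simp only [Valid, h] at hv
    refine ⟨w, num bs, ⟨hws.ne_nil_of_avail hv, asi_le_iff.2 ⟨ws, hws, by omega, hv⟩⟩, ?_⟩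
    rw [encodeInstance, bits_num hbs]
  · rw [mode_foldl_exec_of_stuck (.inl hdead), hdead] at h
    simp at h

/-- The contents of the tape with the words `ws`. -/
def enc (ws : List (List α)) : List (Option α) := ws.flatMap fun u => none :: u.map some

theorem enc_cons (u : List α) (ws : List (List α)) :
    enc (u :: ws) = none :: (u.map some ++ enc ws) :=
  rfl

theorem enc_append (us ws : List (List α)) : enc (us ++ ws) = enc us ++ enc ws := by
  simp [enc]

theorem atBoundary_enc (ws : List (List α)) : atBoundary (enc ws) = true := by
  cases ws <;> rfl

theorem length_enc_le {ws : List (List α)} {n : ℕ} (h : ∀ u ∈ ws, u.length ≤ n) :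
    (enc ws).length ≤ ws.length * (n + 1) := by
  induction ws with
  | nil => simp [enc]
  | cons u ws ih =>
    have hu := h u (by simp)
    have hws := ih fun x hx => h x (List.mem_cons_of_mem _ hx)
    rw [enc_cons]
    simp only [List.length_append, List.length_cons, List.length_map, Nat.add_mul]
    omega

/-- At most `m` commands lead from `c` to `d`. -/
def Reach (m : ℕ) (c d : Conf α) : Prop := ∃ y : List (Cmd α), y.length ≤ m ∧ y.foldl exec c = d

theorem Reach.refl (c : Conf α) : Reach 0 c c := ⟨[], le_rfl, rfl⟩

theorem Reach.trans {m n : ℕ} {c d e : Conf α} (h : Reach m c d) (h' : Reach n d e) :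
    Reach (m + n) c e := by
  obtain ⟨y, hy, rfl⟩ := h
  obtain ⟨z, hz, rfl⟩ := h'
  exact ⟨y ++ z, by simp; omega, by simp⟩

theorem Reach.mono {m n : ℕ} {c d : Conf α} (h : Reach m c d) (hmn : m ≤ n) : Reach n c d :=
  let ⟨y, hy, hd⟩ := h
  ⟨y, hy.trans hmn, hd⟩

theorem Reach.single {c d : Conf α} (x : Cmd α) (h : exec c x = d) : Reach 1 c d :=
  ⟨[x], le_rfl, h⟩

theorem Reach.head {m : ℕ} {c d : Conf α} (x : Cmd α) (h : Reach m (exec c x) d) :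
    Reach (m + 1) c d := by
  obtain ⟨y, hy, rfl⟩ := h
  exact ⟨x :: y, by simpa using hy, rfl⟩

theorem reach_lower (c : Conf α) :
    Reach c.A.length c { c with A := [], B := c.A.reverse ++ c.B } := by
  obtain ⟨m, held, A, B, L, R, N, W⟩ := c
  induction A generalizing B with
  | nil => exact .refl _
  | cons d A ih => simpa using (ih (d :: B)).head .lower

/-- A unit is taken at the lowest nonzero position, and the units that this leaves at the lower
positions are put back on the way. -/
theorem exists_reach_held (c : Conf α) (hheld : c.held = false) (hB : 1 ≤ num c.B) :
    ∃ B, num B + 1 = num c.B ∧ B.length = c.B.length ∧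
      Reach (2 * c.B.length) c { c with held := true, B := B } := by
  obtain ⟨m, _, A, B, L, R, N, W⟩ := c
  obtain rfl := hheld
  induction B generalizing A with
  | nil => simp [num] at hB
  | cons b B ih =>
    cases b
    · obtain ⟨B', hnum, hlen, hreach⟩ := ih (false :: A) (by simp [num, Nat.bit_val] at hB ⊢; omega)
      refine ⟨true :: B', ?_, by simpa using hlen, ?_⟩
      · simp only [num, List.foldr_cons, Nat.bit_val] at hnum ⊢
        simp only [Bool.toNat_true, Bool.toNat_false]
        omega
      · exact ((hreach.trans (.single .give rfl)).head .raise).mono (by simp; omega)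
    · exact ⟨false :: B, by simp [num, Nat.bit_val], rfl,
        (Reach.single .take rfl).mono (by simp; omega)⟩

theorem reach_right {c : Conf α} (hc : c.mode = .free) {X R : List (Option α)}
    (hR : c.R = X ++ R) : Reach X.length c { c with L := X.reverse ++ c.L, R := R } := by
  obtain ⟨_, held, A, B, L, _, N, W⟩ := c
  obtain rfl := hc
  obtain rfl := hR
  induction X generalizing L with
  | nil => exact .refl _
  | cons x X ih => simpa using (ih (x :: L)).head .right

theorem reach_left {c : Conf α} (hc : c.mode = .free) :
    Reach c.L.length c { c with L := [], R := c.L.reverse ++ c.R } := by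
  obtain ⟨_, held, A, B, L, R, N, W⟩ := c
  obtain rfl := hc
  induction L generalizing R with
  | nil => exact .refl _
  | cons x L ih => simpa using (ih (x :: R)).head .left

theorem exec_beginCopy {c : Conf α} {R : List (Option α)} (hc : c.mode = .free)
    (hpaid : (c.held || c.N.isEmpty) = true) (hR : c.R = none :: R) :
    exec c .beginCopy =
      { c with mode := .copying, held := c.held && c.N.isEmpty, L := none :: c.L, R := R } := by
  simp only [exec, hc, hpaid, hR]

theorem exec_endCopy {c : Conf α} (hc : c.mode = .copying) (hR : atBoundary c.R = true) :
    exec c .endCopy = { c with mode := .free } := by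
  simp only [exec, hc, hR]

theorem reach_copy {c : Conf α} (hc : c.mode = .copying) {u : List α} {R : List (Option α)}
    (hR : c.R = u.map some ++ R) :
    Reach u.length c
      { c with L := (u.map some).reverse ++ c.L, R := R, N := u.reverse ++ c.N } := by
  obtain ⟨_, held, A, B, L, _, N, W⟩ := c
  obtain rfl := hc
  obtain rfl := hR
  induction u generalizing L N with
  | nil => exact .refl _
  | cons a u ih => simpa using (ih (some a :: L) (a :: N)).head .copy

theorem reach_put {c : Conf α} (hc : c.mode = .writing) :
    Reach c.N.length c { c with R := c.N.reverse.map some ++ c.R, N := [] } := by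
  obtain ⟨_, held, A, B, L, R, N, W⟩ := c
  obtain rfl := hc
  induction N generalizing R with
  | nil => exact .refl _
  | cons a N ih => exact Reach.head .put (by simpa [exec] using ih (some a :: R))

theorem reach_check {c : Conf α} (hc : c.mode = .comparing) (hN : c.N = c.W) :
    Reach c.W.length c { c with N := [], W := [] } := by
  obtain ⟨_, held, A, B, L, R, N, W⟩ := c
  obtain rfl := hc
  obtain rfl : N = W := hN
  induction N with
  | nil => exact .refl _
  | cons a N ih => exact Reach.head .check (by simpa [exec] using ih)

/-- The configuration with the words `ws` on the tape in which the verifier is free to start with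
the next word: the counter has been lowered and the head is at the left end of the tape. -/
def ready (held : Bool) (B : List Bool) (ws : List (List α)) (N W : List α) : Conf α :=
  ⟨.free, held, [], B, [], enc ws, N, W⟩

section Ready

variable {ws : List (List α)} {B : List Bool} {held : Bool} {N W : List α}

theorem reach_collect {u : List α} (hu : Avail ws u) (hpaid : (held || N.isEmpty) = true) :
    Reach (2 * (enc ws).length + 2) (ready held B ws N W)
      (ready (held && N.isEmpty) B ws (u.reverse ++ N) W) := by
  rcases hu with hu | ⟨a, rfl⟩
  · obtain ⟨us, vs, rfl⟩ := List.append_of_mem hu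
    have hskip := reach_right (c := ready held B (us ++ u :: vs) N W) rfl
      (X := enc us) (R := enc (u :: vs)) (enc_append _ _)
    have hbegin := hskip.trans
      (.single .beginCopy (exec_beginCopy (R := u.map some ++ enc vs) rfl hpaid rfl))
    have hend := (hbegin.trans (reach_copy (R := enc vs) rfl rfl)).trans
      (.single .endCopy (exec_endCopy rfl (atBoundary_enc vs)))
    have hback := hend.trans (reach_left rfl)
    refine Reach.mono (by simpa [ready, enc_append, enc_cons] using hback) ?_
    simp [enc_append, enc_cons]
    omega
  · exact (Reach.single (.letter a) (by simp [exec, ready, hpaid])).mono (by omega)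

theorem reach_write :
    Reach (N.length + 2) (ready held B ws N W) (ready held B (N.reverse :: ws) [] W) := by
  have hinsert : Reach 1 (ready held B ws N W) { ready held B ws N W with mode := .writing } :=
    .single .insert (by simp [exec, ready, atBoundary_enc])
  have hfinish := (hinsert.trans (reach_put rfl)).trans
    (Reach.single .finish (d := ready held B (N.reverse :: ws) [] W) rfl)
  exact hfinish.mono (by simp [ready]; omega)

theorem exists_reach_cons (hws : Assembled ws) {u v : List α} (hu : Avail ws u) (hv : Avail ws v)
    (hB : 1 ≤ num B) :
    ∃ B', num B' + 1 = num B ∧ B'.length = B.length ∧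
      Reach (2 * B.length + 4 * (enc ws).length + (u ++ v).length + 6)
        (ready false B ws [] W) (ready false B' ((u ++ v) :: ws) [] W) := by
  obtain ⟨B', hnum, hlen, htake⟩ := exists_reach_held (ready false B ws [] W) rfl hB
  refine ⟨B', hnum, hlen, ?_⟩
  have hleft : Reach (2 * (enc ws).length + 2) (ready true B' ws [] W)
      (ready true B' ws u.reverse W) := by
    simpa using reach_collect (held := true) (N := []) hu rfl
  have hright : Reach (2 * (enc ws).length + 2) (ready true B' ws u.reverse W)
      (ready false B' ws (u ++ v).reverse W) := by
    simpa [List.isEmpty_eq_false_iff.2 (hws.ne_nil_of_avail hu)] using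
      reach_collect (held := true) (N := u.reverse) hv rfl
  have hwrite : Reach ((u ++ v).length + 2) (ready false B' ws (u ++ v).reverse W)
      (ready false B' ((u ++ v) :: ws) [] W) := by
    simpa only [List.length_reverse, List.reverse_reverse] using
      reach_write (N := (u ++ v).reverse)
  exact (((htake.trans hleft).trans hright).trans hwrite).mono (by simp only [ready]; omega)

theorem exists_reach_assembled (hws : Assembled ws) {n : ℕ} (hlen : ws.length ≤ n)
    (hwords : ∀ u ∈ ws, u.length ≤ n) (hlenB : B.length ≤ n) (hB : ws.length ≤ num B) :
    ∃ B', num B' + ws.length = num B ∧ B'.length = B.length ∧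
      Reach (ws.length * (4 * (n * (n + 1)) + 3 * n + 6))
        (ready false B [] [] W) (ready false B' ws [] W) := by
  induction hws with
  | nil => exact ⟨B, rfl, rfl, (Reach.refl _).mono (by simp)⟩
  | @cons ws u v hws hu hv ih =>
    rw [List.length_cons] at hlen hB
    have hwords' : ∀ x ∈ ws, x.length ≤ n := fun x hx => hwords x (List.mem_cons_of_mem _ hx)
    obtain ⟨B', hnum', hlen', hreach'⟩ := ih (by omega) hwords' (by omega)
    obtain ⟨B'', hnum'', hlen'', hreach''⟩ := exists_reach_cons hws hu hv (B := B') (by omega)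
    refine ⟨B'', by rw [List.length_cons]; omega, by omega, (hreach'.trans hreach'').mono ?_⟩
    have henc : (enc ws).length ≤ n * (n + 1) :=
      (length_enc_le hwords').trans (Nat.mul_le_mul_right _ (by omega))
    have huv := hwords (u ++ v) (by simp)
    rw [List.length_cons, Nat.add_mul, Nat.one_mul]
    omega

theorem exists_reach_done (hW : W ≠ []) :
    ∃ c, c.mode = .done ∧ Reach (W.length + 2) (ready held B ws W W) c := by
  have hcompare : Reach 1 (ready held B ws W W) { ready held B ws W W with mode := .comparing } :=
    .single .compare (by cases W <;> first | exact absurd rfl hW | rfl)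
  exact ⟨_, rfl, (((hcompare.trans (reach_check rfl rfl)).trans
    (Reach.single .accept rfl)).mono (by simp [ready]; omega))⟩

end Ready

theorem getLast?_bits_ne (k : ℕ) : k.bits.getLast? ≠ some false := by
  induction k using Nat.binaryRec' with
  | zero => simp
  | bit b n h ih =>
    rw [Nat.bits_append_bit _ _ h, List.getLast?_cons]
    rcases hn : n.bits.getLast? with _ | d
    · have hbits : n.bits = [] := by simpa using hn
      have hzero : n = 0 := by simpa [hbits, num] using (num_bits n).symm
      simp [h hzero]
    · simpa [hn] using ih

theorem reach_ready_bits (w : List α) (k : ℕ) :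
    Reach (k.bits.length + 1) (afterReading w k.bits) (ready false k.bits [] [] w.reverse) := by
  have hstart : exec (afterReading w k.bits) .start =
      { afterReading w k.bits with mode := .free } := by
    rcases hb : k.bits.getLast? with _ | _ | _
    · simp [exec, afterReading, hb]
    · exact absurd hb (getLast?_bits_ne k)
    · simp [exec, afterReading, hb]
  refine Reach.head .start ?_
  rw [hstart]
  simpa [afterReading, ready, enc] using reach_lower { afterReading w k.bits with mode := .free }

/-- A bound on the length of the certificates. -/
noncomputable def bound : Polynomial ℕ :=
  open Polynomial in
  (X + 1) + X * (4 * (X * (X + 1)) + 3 * X + 6) + (2 * (X * (X + 1)) + 2) + (X + 2)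

theorem exists_mode_eq_done {x : List (α ⊕ Bool)} (hx : x ∈ asiDecLanguage α) :
    ∃ y : List (Cmd α), y.length ≤ bound.eval x.length ∧
      (y.foldl exec (x.foldl (fun c a => step c (.inl a)) initial)).mode = .done := by
  obtain ⟨w, k, ⟨hw, hk⟩, rfl⟩ := hx
  simp only at hw hk
  obtain ⟨ws, hws, hlenk, hlenw, hwords, havail⟩ := exists_assembled_of_asi_le hw hk
  have hlen : (encodeInstance w k).length = w.length + k.bits.length := by simp [encodeInstance]
  set n := (encodeInstance w k).length
  have hwords' : ∀ u ∈ ws, u.length ≤ n := fun u hu => (hwords u hu).trans (by omega)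
  obtain ⟨B, -, -, hassemble⟩ := exists_reach_assembled hws (n := n) (W := w.reverse)
    (by omega) hwords' (B := k.bits) (by omega) (by rwa [num_bits])
  have hcollect : Reach (2 * (enc ws).length + 2) (ready false B ws [] w.reverse)
      (ready false B ws w.reverse w.reverse) := by
    simpa using reach_collect (held := false) (N := []) havail rfl
  obtain ⟨c, hc, hdone⟩ := exists_reach_done (held := false) (B := B) (ws := ws)
    (List.reverse_ne_nil_iff.2 hw)
  obtain ⟨y, hy, rfl⟩ :=
    (((reach_ready_bits w k).trans hassemble).trans hcollect).trans hdone
  rw [encodeInstance, foldl_step_letters_digits]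
  refine ⟨y, hy.trans ?_, hc⟩
  have henc : (enc ws).length ≤ n * (n + 1) :=
    (length_enc_le hwords').trans (Nat.mul_le_mul_right _ (by omega))
  have hmul := Nat.mul_le_mul_right (4 * (n * (n + 1)) + 3 * n + 6) (by omega : ws.length ≤ n)
  simp only [bound, Polynomial.eval_add, Polynomial.eval_mul, Polynomial.eval_X,
    Polynomial.eval_one, Polynomial.eval_ofNat, List.length_reverse]
  omega

end Verifier

open Verifier in
theorem inNP_asiDecLanguage (α : Type) [Finite α] : InNP (asiDecLanguage α) := by
  have := Fintype.ofFinite α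
  refine ⟨Cmd α, inferInstance, bound, _, ⟨(machine α).computableInPolyTime _⟩, fun x => ?_⟩
  have haccepts (y : List (Cmd α)) :
      (machine α).accepts (x.map Sum.inl ++ y.map Sum.inr) = true ↔
        (y.foldl exec (x.foldl (fun c a => step c (.inl a)) initial)).mode = .done := by
    rw [accepts_machine_iff, List.foldl_append, List.foldl_map, List.foldl_map]
    rfl
  simp only [haccepts]
  exact ⟨exists_mode_eq_done, fun ⟨y, _, hy⟩ => mem_asiDecLanguage_of_mode_eq_done hy⟩

end Assembly

/-! ### Random access machines -/

namespace RAM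

open Function

/-- No number in the registers and the memory exceeds `W`. -/
def Cfg.BoundedBy (W : ℕ) (c : Cfg) : Prop := (∀ i, c.reg i ≤ W) ∧ ∀ i, c.mem i ≤ W

/-- From the configuration the machine stops within `T` steps with the answer whether `φ` holds, and
if no number exceeds `W` in the configuration, then none does on the way. -/
inductive Halts (P : Program) (W : ℕ) (φ : Prop) : ℕ → Cfg → Prop
  | halt {T : ℕ} {c : Cfg} {ans : Bool} :
      P[c.pc]? = some (.halt ans) → (ans = true ↔ φ) → Halts P W φ T c
  | step {T : ℕ} {c c' : Cfg} : Halts P W φ T c' → RAM.step P c = some c' →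
      (c.BoundedBy W → c'.BoundedBy W) → Halts P W φ (T + 1) c

variable {P : Program} {W T : ℕ} {φ : Prop}

theorem Halts.mono {T' : ℕ} {c : Cfg} (h : Halts P W φ T c) (hT : T ≤ T') : Halts P W φ T' c := by
  induction h generalizing T' with
  | halt hP hφ => exact .halt hP hφ
  | step _ hs hB ih =>
    obtain ⟨T', rfl⟩ := Nat.exists_eq_add_of_le' hT
    exact .step (ih (by omega : _ ≤ T' + _)) hs hB

theorem Halts.exists_iterate {c : Cfg} (h : Halts P W φ T c) :
    ∃ m ≤ T, ∃ (c' : Cfg) (ans : Bool), (fun o => o.bind (RAM.step P))^[m] (some c) = some c' ∧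
      P[c'.pc]? = some (.halt ans) ∧ (ans = true ↔ φ) := by
  induction h with
  | @halt T c ans hP hφ => exact ⟨0, Nat.zero_le _, c, ans, rfl, hP, hφ⟩
  | step _ hs _ ih =>
    obtain ⟨m, hm, c', ans, hrun, hP, hφ⟩ := ih
    refine ⟨m + 1, Nat.succ_le_succ hm, c', ans, ?_, hP, hφ⟩
    rw [iterate_succ_apply, Option.bind_some, hs, hrun]

theorem Halts.boundedBy_of_iterate {c : Cfg} (h : Halts P W φ T c) (hc : c.BoundedBy W) {m : ℕ}
    {c' : Cfg} (hrun : (fun o => o.bind (RAM.step P))^[m] (some c) = some c') :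
    c'.BoundedBy W := by
  induction h generalizing m with
  | halt hP _ =>
    cases m with
    | zero => exact Option.some.inj hrun ▸ hc
    | succ m =>
      rw [iterate_succ_apply, Option.bind_some, RAM.step, hP, iterate_fixed (by rfl)] at hrun
      simp at hrun
  | step _ hs hB ih =>
    cases m with
    | zero => exact Option.some.inj hrun ▸ hc
    | succ m =>
      rw [iterate_succ_apply, Option.bind_some, hs] at hrun
      exact ih (hB hc) hrun

theorem Halts.decidesWithin {input : List ℕ} (h : Halts P W φ T (init input)) :
    DecidesWithin P input φ T :=
  h.exists_iterate

theorem Halts.wordsBoundedBy {input : List ℕ} (h : Halts P W φ T (init input))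
    (hinput : ∀ x ∈ input, x ≤ W) : WordsBoundedBy P input W := by
  refine fun m c hrun => h.boundedBy_of_iterate ⟨fun _ => Nat.zero_le _, fun i => ?_⟩ hrun
  change input.getD i 0 ≤ W
  rw [List.getD_eq_getElem?_getD]
  rcases hx : input[i]? with _ | x
  · exact Nat.zero_le _
  · exact hinput x (List.mem_of_getElem? hx)

section Instructions

variable {pc d a b l v x : ℕ} {r m : ℕ → ℕ}

theorem update_le {f : ℕ → ℕ} (hf : ∀ i, f i ≤ W) (hv : v ≤ W) (i : ℕ) : update f d v i ≤ W := by
  rw [update_apply]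
  split_ifs
  · exact hv
  · exact hf i

theorem Halts.const (hi : P[pc]? = some (.const d v)) (hv : v ≤ W)
    (h : Halts P W φ T ⟨pc + 1, update r d v, m⟩) : Halts P W φ (T + 1) ⟨pc, r, m⟩ :=
  .step h (by simp [RAM.step, hi]) (fun hB => ⟨update_le hB.1 hv, hB.2⟩)

theorem Halts.move (v : ℕ) (hi : P[pc]? = some (.move d a)) (hv : r a = v)
    (h : Halts P W φ T ⟨pc + 1, update r d v, m⟩) : Halts P W φ (T + 1) ⟨pc, r, m⟩ :=
  .step h (by simp [RAM.step, hi, hv]) (fun hB => ⟨update_le hB.1 (hv.ge.trans (hB.1 a)), hB.2⟩)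

theorem Halts.add (v : ℕ) (hi : P[pc]? = some (.add d a b)) (hv : r a + r b = v) (hW : v ≤ W)
    (h : Halts P W φ T ⟨pc + 1, update r d v, m⟩) : Halts P W φ (T + 1) ⟨pc, r, m⟩ :=
  .step h (by simp [RAM.step, hi, hv]) (fun hB => ⟨update_le hB.1 hW, hB.2⟩)

theorem Halts.sub (v : ℕ) (hi : P[pc]? = some (.sub d a b)) (hv : r a - r b = v)
    (h : Halts P W φ T ⟨pc + 1, update r d v, m⟩) : Halts P W φ (T + 1) ⟨pc, r, m⟩ :=
  .step h (by simp [RAM.step, hi, hv])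
    (fun hB => ⟨update_le hB.1 (hv.ge.trans ((Nat.sub_le _ _).trans (hB.1 a))), hB.2⟩)

theorem Halts.load (x v : ℕ) (hi : P[pc]? = some (.load d a)) (hx : r a = x) (hv : m x = v)
    (h : Halts P W φ T ⟨pc + 1, update r d v, m⟩) : Halts P W φ (T + 1) ⟨pc, r, m⟩ :=
  .step h (by simp [RAM.step, hi, hx, hv])
    (fun hB => ⟨update_le hB.1 (hv.ge.trans (hB.2 x)), hB.2⟩)

theorem Halts.store (x v : ℕ) (hi : P[pc]? = some (.store a b)) (hx : r a = x) (hv : r b = v)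
    (h : Halts P W φ T ⟨pc + 1, r, update m x v⟩) : Halts P W φ (T + 1) ⟨pc, r, m⟩ :=
  .step h (by simp [RAM.step, hi, hx, hv])
    (fun hB => ⟨hB.1, update_le hB.2 (hv.ge.trans (hB.1 b))⟩)

theorem Halts.jump (hi : P[pc]? = some (.jump l)) (h : Halts P W φ T ⟨l, r, m⟩) :
    Halts P W φ (T + 1) ⟨pc, r, m⟩ :=
  .step h (by simp [RAM.step, hi]) id

theorem Halts.jumpLT_of_lt (hi : P[pc]? = some (.jumpLT a b l)) (hlt : r a < r b)
    (h : Halts P W φ T ⟨l, r, m⟩) : Halts P W φ (T + 1) ⟨pc, r, m⟩ :=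
  .step h (by simp [RAM.step, hi, hlt]) id

theorem Halts.jumpLT_of_le (hi : P[pc]? = some (.jumpLT a b l)) (hle : r b ≤ r a)
    (h : Halts P W φ T ⟨pc + 1, r, m⟩) : Halts P W φ (T + 1) ⟨pc, r, m⟩ :=
  .step h (by simp [RAM.step, hi, hle.not_gt]) id

theorem Halts.jumpEQ_of_eq (hi : P[pc]? = some (.jumpEQ a b l)) (heq : r a = r b)
    (h : Halts P W φ T ⟨l, r, m⟩) : Halts P W φ (T + 1) ⟨pc, r, m⟩ :=
  .step h (by simp [RAM.step, hi, heq]) id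

theorem Halts.jumpEQ_of_ne (hi : P[pc]? = some (.jumpEQ a b l)) (hne : r a ≠ r b)
    (h : Halts P W φ T ⟨pc + 1, r, m⟩) : Halts P W φ (T + 1) ⟨pc, r, m⟩ :=
  .step h (by simp [RAM.step, hi, hne]) id

end Instructions

end RAM

namespace Assembly

/-! ### Plans and their codes -/

variable {α : Type}

theorem Ptr.resolve_of_prefix {xs ys : List (List α)} (h : xs <+: ys) {a : Ptr α} {u : List α}
    (hu : a.resolve xs = some u) : a.resolve ys = some u := by
  cases a with
  | letter a => exact hu
  | step j =>
    obtain ⟨hj, rfl⟩ := List.getElem?_eq_some_iff.1 hu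
    exact List.prefix_iff_getElem?.1 h j hj

theorem Ptr.isSome_resolve_iff {s : ℕ} (e : α ≃ Fin s) (xs : List (List α)) (a : Ptr α) :
    (a.resolve xs).isSome ↔ a.code e < s + xs.length := by
  cases a with
  | letter a => simpa [Ptr.resolve, Ptr.code] using (e a).2.trans_le (Nat.le_add_right _ _)
  | step j => simp [Ptr.resolve, Ptr.code]

theorem Plan.prefix_of_evalFrom {ys xs : List (List α)} {p : Plan α}
    (h : Plan.evalFrom ys p = some xs) : ys <+: xs := by
  induction p generalizing ys with
  | nil => exact Option.some.inj h ▸ List.prefix_rfl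
  | cons x p ih =>
    obtain ⟨a, b⟩ := x
    rw [Plan.evalFrom] at h
    split at h
    · exact (List.prefix_append _ _).trans (ih h)
    · simp at h

theorem Plan.length_of_evalFrom {p : Plan α} {xs : List (List α)}
    (h : Plan.evalFrom [] p = some xs) : xs.length = p.length := by
  simpa using (Assembled.nil.of_evalFrom (p := p) h).2

theorem Plan.ne_nil_of_resolve {p : Plan α} {xs : List (List α)}
    (h : Plan.evalFrom [] p = some xs) {a : Ptr α} {u : List α} (hu : a.resolve xs = some u) :
    u ≠ [] :=
  (Assembled.nil.of_evalFrom (p := p) h).1.ne_nil_of_avail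
    (Ptr.avail_of_resolve (by simpa using hu))

theorem Plan.evalFrom_cons_eq_some_iff {ys xs : List (List α)} {a b : Ptr α} {p : Plan α} :
    Plan.evalFrom ys ((a, b) :: p) = some xs ↔ ∃ u v, a.resolve ys = some u ∧
      b.resolve ys = some v ∧ Plan.evalFrom (ys ++ [u ++ v]) p = some xs := by
  rw [Plan.evalFrom]
  cases a.resolve ys <;> cases b.resolve ys <;> simp

theorem Plan.exists_evalFrom_take {p : Plan α} {xs : List (List α)}
    (h : Plan.evalFrom [] p = some xs) {i : ℕ} {a b : Ptr α} (hi : p[i]? = some (a, b)) :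
    ∃ ys u v, Plan.evalFrom [] (p.take i) = some ys ∧ a.resolve ys = some u ∧
      b.resolve ys = some v ∧ ys ++ [u ++ v] <+: xs := by
  obtain ⟨hlt, hget⟩ := List.getElem?_eq_some_iff.1 hi
  rw [← List.take_append_drop i p, List.drop_eq_getElem_cons hlt, hget, Plan.evalFrom_append,
    Option.bind_eq_some_iff] at h
  obtain ⟨ys, hys, hrest⟩ := h
  obtain ⟨u, v, hu, hv, hrest⟩ := Plan.evalFrom_cons_eq_some_iff.1 hrest
  exact ⟨ys, u, v, hys, hu, hv, Plan.prefix_of_evalFrom hrest⟩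

theorem Plan.exists_getElem?_eq_append {p : Plan α} {xs : List (List α)}
    (h : Plan.evalFrom [] p = some xs) {i : ℕ} {a b : Ptr α} (hi : p[i]? = some (a, b)) :
    ∃ u v, a.resolve xs = some u ∧ b.resolve xs = some v ∧ xs[i]? = some (u ++ v) := by
  obtain ⟨ys, u, v, hys, hu, hv, hxs⟩ := Plan.exists_evalFrom_take h hi
  have hprefix := (List.prefix_append ys [u ++ v]).trans hxs
  have hlen : ys.length = i := by
    have hlt := (List.getElem?_eq_some_iff.1 hi).1
    rw [Plan.length_of_evalFrom hys, List.length_take_of_le hlt.le]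
  exact ⟨u, v, Ptr.resolve_of_prefix hprefix hu, Ptr.resolve_of_prefix hprefix hv,
    (List.prefix_iff_getElem?.1 hxs i (by simp [hlen])).trans (by simp [← hlen])⟩

theorem Plan.exists_evalFrom_take_succ_iff {p : Plan α} {i : ℕ} {a b : Ptr α}
    (hi : p[i]? = some (a, b)) {xs : List (List α)}
    (hxs : Plan.evalFrom [] (p.take i) = some xs) :
    (∃ ys, Plan.evalFrom [] (p.take (i + 1)) = some ys) ↔
      (a.resolve xs).isSome ∧ (b.resolve xs).isSome := by
  rw [List.take_add_one, hi, Plan.evalFrom_append, hxs]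
  cases ha : a.resolve xs <;> cases hb : b.resolve xs <;> simp [Plan.evalFrom, ha, hb]

theorem Plan.exists_evalFrom_take_of_builds {p : Plan α} {w : List α} (h : p.Builds w) (i : ℕ) :
    ∃ xs, Plan.evalFrom [] (p.take i) = some xs := by
  obtain ⟨xs, hxs, -⟩ := h
  rw [← List.take_append_drop i p, Plan.evalFrom_append, Option.bind_eq_some_iff] at hxs
  exact hxs.imp fun _ h => h.1

section Codes

variable {s : ℕ} (e : α ≃ Fin s) (w : List α) (k : ℕ) (p : Plan α)

theorem Plan.codes_cons (x : Ptr α × Ptr α) :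
    Plan.codes e (x :: p) = x.1.code e :: x.2.code e :: Plan.codes e p :=
  rfl

theorem Plan.length_codes : (Plan.codes e p).length = 2 * p.length := by
  induction p with
  | nil => rfl
  | cons x p ih => simp only [Plan.codes_cons, List.length_cons, ih]; omega

theorem Plan.getD_codes {i : ℕ} {a b : Ptr α} (hi : p[i]? = some (a, b)) :
    (Plan.codes e p).getD (2 * i) 0 = a.code e ∧
      (Plan.codes e p).getD (2 * i + 1) 0 = b.code e := by
  induction p generalizing i with
  | nil => simp at hi
  | cons x p ih =>
    cases i with
    | zero =>
      obtain rfl : x = (a, b) := by simpa using hi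
      simp [Plan.codes_cons]
    | succ i => simpa [Plan.codes_cons, Nat.mul_add] using ih (by simpa using hi)

theorem Plan.length_bits :
    (Plan.bits e p).length = 2 * p.length * Nat.size (s + p.length) := by
  simp [Plan.bits, Plan.length_codes]

theorem Plan.length_bits_le (hp : p.length < w.length) (hw : 2 ≤ w.length) :
    (Plan.bits e p).length ≤ (2 * s + 4) * w.length * Nat.log 2 w.length := by
  have hlog : 1 ≤ Nat.log 2 w.length := Nat.log_pos one_lt_two hw
  have hsize : Nat.size (s + p.length) ≤ s + (Nat.log 2 w.length + 1) := by
    rw [Nat.size_le, pow_add]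
    calc s + p.length < (s + 1) * w.length := by nlinarith
      _ ≤ 2 ^ s * 2 ^ (Nat.log 2 w.length + 1) :=
        Nat.mul_le_mul Nat.lt_two_pow_self (Nat.lt_pow_succ_log_self one_lt_two _).le
  rw [Plan.length_bits]
  calc 2 * p.length * Nat.size (s + p.length)
      ≤ 2 * w.length * ((s + 2) * Nat.log 2 w.length) :=
        Nat.mul_le_mul (by omega) (hsize.trans (by nlinarith))
    _ = (2 * s + 4) * w.length * Nat.log 2 w.length := by ring

theorem getD_verifierInput_word {i : ℕ} (hi : i < w.length) :
    (verifierInput e w k p).getD (3 + i) 0 = e w[i] := by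
  rw [verifierInput, List.append_assoc, List.getD_append_right _ _ _ _ (by simp),
    List.getD_append _ _ _ _ (by simpa using hi)]
  simp [hi]

theorem getD_verifierInput_plan (i : ℕ) :
    (verifierInput e w k p).getD (3 + w.length + i) 0 = (Plan.codes e p).getD i 0 := by
  rw [verifierInput, List.getD_append_right _ _ _ _ (by simp; omega)]
  congr 1
  simp only [List.length_append, List.length_cons, List.length_nil, List.length_map]
  omega

end Codes

/-! ### Checking plans on a random access machine -/

/-- The verifier for an alphabet of `s` letters. It checks the pointers, and then expands the last
step with a stack of pointers, comparing letters with `w`.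
Registers: `0` holds `1`, `1` the size of the alphabet, `5` and `10` the end of `w` and the current
position in `w`, `6` and `11` the bottom and the top of the stack, `7` the address of the pointer
being checked, `8` the bound for its value, and `14` the largest legal value of the sum of `10` and
`11`. -/
def verifierProgram (s : ℕ) : RAM.Program :=
  [.const 0 1, .const 1 s, .load 2 12, .load 3 0, .add 13 0 0, .load 4 13,
   .jumpLT 3 4 17, .jumpEQ 4 12 17, .const 10 3, .add 5 10 2, .move 7 5, .add 6 5 4, .add 6 6 4,
   .move 8 1,
   -- 14: checking the pointers
   .jumpEQ 7 6 25, .load 9 7, .jumpLT 9 8 18, .halt false,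
   .add 7 7 0, .load 9 7, .jumpLT 9 8 22, .halt false, .add 7 7 0, .add 8 8 0, .jump 14,
   -- 25: initializing the stack
   .sub 9 8 0, .store 6 9, .add 11 6 0, .add 14 6 5,
   -- 29: the next pointer
   .jumpEQ 11 6 51, .sub 11 11 0, .load 9 11, .jumpLT 9 1 46,
   -- 33: a pointer to a step
   .sub 9 9 1, .add 9 9 9, .add 9 9 5, .add 13 9 0, .load 13 13, .load 9 9, .store 11 13,
   .add 11 11 0, .store 11 9, .add 11 11 0, .add 13 11 10, .jumpLT 14 13 17, .jump 29,
   -- 46: a pointer to a letter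
   .load 13 10, .jumpEQ 13 9 49, .halt false, .add 10 10 0, .jump 29,
   -- 51: the end
   .jumpEQ 10 5 53, .halt false, .halt true]

open Function RAM

variable {s : ℕ}

/-- The memory from address `base` on holds the stack `st` (the top first). -/
def HoldsStack (e : α ≃ Fin s) (m : ℕ → ℕ) (base : ℕ) : List (Ptr α) → Prop
  | [] => True
  | a :: st => m (base + st.length) = a.code e ∧ HoldsStack e m base st

theorem HoldsStack.update {e : α ≃ Fin s} {m : ℕ → ℕ} {base : ℕ} {st : List (Ptr α)}
    (h : HoldsStack e m base st) {x v : ℕ} (hx : base + st.length ≤ x) :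
    HoldsStack e (update m x v) base st := by
  induction st with
  | nil => trivial
  | cons a st ih =>
    rw [List.length_cons] at hx
    exact ⟨by rw [update_of_ne (by omega)]; exact h.1, ih h.2 (by omega)⟩

/-- The concatenation of the words that the pointers refer to. -/
def expand (xs : List (List α)) (st : List (Ptr α)) : List α :=
  st.flatMap fun a => (a.resolve xs).getD []

theorem expand_cons {xs : List (List α)} {a : Ptr α} {u : List α} (h : a.resolve xs = some u)
    (st : List (Ptr α)) : expand xs (a :: st) = u ++ expand xs st := by
  simp [expand, h]

theorem expand_letter_cons (xs : List (List α)) (a : α) (st : List (Ptr α)) :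
    expand xs (.letter a :: st) = a :: expand xs st :=
  expand_cons (a := .letter a) rfl st

theorem expand_step_cons {p : Plan α} {xs : List (List α)} (hp : Plan.evalFrom [] p = some xs)
    {j : ℕ} {a b : Ptr α} (hj : p[j]? = some (a, b)) (st : List (Ptr α)) :
    expand xs (.step j :: st) = expand xs (a :: b :: st) := by
  obtain ⟨u, v, ha, hb, hxj⟩ := Plan.exists_getElem?_eq_append hp hj
  rw [expand_cons (a := .step j) hxj, expand_cons ha, expand_cons hb, List.append_assoc]

theorem length_le_length_expand {p : Plan α} {xs : List (List α)}
    (hp : Plan.evalFrom [] p = some xs) {st : List (Ptr α)}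
    (hst : ∀ a ∈ st, (a.resolve xs).isSome) : st.length ≤ (expand xs st).length := by
  induction st with
  | nil => simp
  | cons a st ih =>
    rw [List.forall_mem_cons] at hst
    obtain ⟨u, hu⟩ := Option.isSome_iff_exists.1 hst.1
    have hpos := List.length_pos_of_ne_nil (Plan.ne_nil_of_resolve hp hu)
    have htail := ih hst.2
    rw [expand_cons hu, List.length_append, List.length_cons]
    omega

section Verifier

variable (e : α ≃ Fin s) (w : List α) (k : ℕ) (p : Plan α)

/-- What both loops of the verifier preserve: the constant registers, and the input in the memory
below the stack. -/
structure Prepared (r m : ℕ → ℕ) : Prop where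
  one : r 0 = 1
  card : r 1 = s
  wordEnd : r 5 = 3 + w.length
  stackBottom : r 6 = 3 + w.length + 2 * p.length
  input : ∀ i < 3 + w.length + 2 * p.length, m i = (verifierInput e w k p).getD i 0

/-- The invariant of the first loop: the pointers of the first `i` steps are legal. -/
structure Checking (i : ℕ) (r m : ℕ → ℕ) : Prop extends Prepared e w k p r m where
  pointer : r 7 = 3 + w.length + 2 * i
  bound : r 8 = s + i
  position : r 10 = 3
  legal : ∃ xs, Plan.evalFrom [] (p.take i) = some xs

/-- The invariant of the second loop: `w` agrees with the word to be built up to the position `pos`,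
and the pointers `st` to the words that have to follow there are on the stack. The steps have the
results `xs`. -/
structure Expanding (xs : List (List α)) (pos : ℕ) (st : List (Ptr α)) (r m : ℕ → ℕ) : Prop
    extends Prepared e w k p r m where
  position : r 10 = 3 + pos
  stackTop : r 11 = 3 + w.length + 2 * p.length + st.length
  limit : r 14 = 6 + 2 * w.length + 2 * p.length
  stack : HoldsStack e m (3 + w.length + 2 * p.length) st
  fits : pos + st.length ≤ w.length
  resolves : ∀ a ∈ st, (a.resolve xs).isSome

variable {e w k p} {r m : ℕ → ℕ} {W T : ℕ} {xs : List (List α)} {pos : ℕ} {st : List (Ptr α)}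

theorem Prepared.word (h : Prepared e w k p r m) {i : ℕ} (hi : i < w.length) :
    m (3 + i) = e w[i] := by
  rw [h.input _ (by omega), getD_verifierInput_word e w k p hi]

theorem Prepared.plan (h : Prepared e w k p r m) {i : ℕ} {a b : Ptr α}
    (hi : p[i]? = some (a, b)) :
    m (3 + w.length + 2 * i) = a.code e ∧ m (3 + w.length + 2 * i + 1) = b.code e := by
  have hlt := (List.getElem?_eq_some_iff.1 hi).1
  rw [h.input _ (by omega), h.input _ (by omega), Nat.add_assoc _ (2 * i),
    getD_verifierInput_plan, getD_verifierInput_plan]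
  exact Plan.getD_codes e p hi

theorem Prepared.congr (h : Prepared e w k p r m) {r' m' : ℕ → ℕ}
    (hr : ∀ i ∈ [0, 1, 5, 6], r' i = r i)
    (hm : ∀ i < 3 + w.length + 2 * p.length, m' i = m i) : Prepared e w k p r' m' := by
  simp only [List.forall_mem_cons, List.not_mem_nil, IsEmpty.forall_iff, implies_true] at hr
  obtain ⟨h0, h1, h5, h6, -⟩ := hr
  exact ⟨h0.trans h.one, h1.trans h.card, h5.trans h.wordEnd, h6.trans h.stackBottom,
    fun i hi => (hm i hi).trans (h.input i hi)⟩

theorem Expanding.halts_of_nil (h : Expanding e w k p xs pos [] r m) :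
    Halts (verifierProgram s) W (expand xs [] = w.drop pos) 3 ⟨29, r, m⟩ := by
  have hexpand : expand xs [] = w.drop pos ↔ pos = w.length := by
    have := h.fits
    simp only [expand, List.flatMap_nil, eq_comm (a := []), List.drop_eq_nil_iff]
    simp only [List.length_nil] at this
    omega
  refine .jumpEQ_of_eq (l := 51) rfl (by simp [h.stackTop, h.stackBottom]) ?_
  by_cases hpos : pos = w.length
  · refine .jumpEQ_of_eq (l := 53) rfl (by simp [h.position, h.wordEnd, hpos]) ?_
    exact .halt rfl (by simpa [hexpand] using hpos)
  · refine .jumpEQ_of_ne rfl (by simpa [h.position, h.wordEnd] using hpos) ?_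
    exact .halt rfl (by simpa [hexpand] using hpos)

theorem Expanding.halts_of_letter {a : α} (hW : 3 + w.length ≤ W)
    (h : Expanding e w k p xs pos (.letter a :: st) r m)
    (hnext : ∀ r', Expanding e w k p xs (pos + 1) st r' m →
      Halts (verifierProgram s) W (expand xs st = w.drop (pos + 1)) T ⟨29, r', m⟩) :
    Halts (verifierProgram s) W (expand xs (.letter a :: st) = w.drop pos) (T + 8)
      ⟨29, r, m⟩ := by
  obtain ⟨hcode, hstack⟩ := h.stack
  have hfits := h.fits
  rw [List.length_cons] at hfits
  have hpos : pos < w.length := by omega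
  rw [expand_letter_cons, List.drop_eq_getElem_cons hpos, List.cons.injEq]
  refine .jumpEQ_of_ne rfl (by simp [h.stackTop, h.stackBottom]) ?_
  refine .sub (3 + w.length + 2 * p.length + st.length) rfl
    (by simp only [h.stackTop, h.one, List.length_cons]; omega) ?_
  refine .load _ _ rfl (by simp) hcode ?_
  refine .jumpLT_of_lt (l := 46) rfl (by simp [h.card, Ptr.code]) ?_
  refine .load _ _ rfl (by simp [h.position]) (h.word hpos) ?_
  by_cases ha : a = w[pos]
  · refine .jumpEQ_of_eq (l := 49) rfl (by simp [Ptr.code, ha]) ?_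
    refine .add (3 + (pos + 1)) rfl (by simp [h.position, h.one]; omega) (by omega) ?_
    refine .jump (l := 29) rfl ?_
    simp only [ha, true_and]
    exact hnext _ { h.congr (by simp) fun _ _ => rfl with
      position := by simp
      stackTop := by simp
      limit := by simp [h.limit]
      stack := hstack
      fits := by omega
      resolves := (List.forall_mem_cons.1 h.resolves).2 }
  · refine .jumpEQ_of_ne rfl (by simpa [Ptr.code, Fin.val_inj] using Ne.symm ha) ?_
    exact .halt rfl (by simp [ha])

theorem Expanding.resolves_of_step (hp : Plan.evalFrom [] p = some xs) {j : ℕ} {a b : Ptr α}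
    (hj : p[j]? = some (a, b)) (h : Expanding e w k p xs pos (.step j :: st) r m) :
    ∀ c ∈ a :: b :: st, (c.resolve xs).isSome := by
  obtain ⟨u, v, ha, hb, -⟩ := Plan.exists_getElem?_eq_append hp hj
  rw [List.forall_mem_cons, List.forall_mem_cons, ha, hb]
  exact ⟨rfl, rfl, (List.forall_mem_cons.1 h.resolves).2⟩

theorem Prepared.halts_of_push (hp : Plan.evalFrom [] p = some xs) {a b : Ptr α}
    (hW : 10 + 2 * w.length + 2 * p.length ≤ W) (h : Prepared e w k p r m)
    (hleft : r 9 = a.code e) (hright : r 13 = b.code e) (hposition : r 10 = 3 + pos)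
    (htop : r 11 = 3 + w.length + 2 * p.length + st.length)
    (hlimit : r 14 = 6 + 2 * w.length + 2 * p.length)
    (hstack : HoldsStack e m (3 + w.length + 2 * p.length) st)
    (hfits : pos + st.length < w.length) (hres : ∀ c ∈ a :: b :: st, (c.resolve xs).isSome)
    (hnext : ∀ r' m', Expanding e w k p xs pos (a :: b :: st) r' m' →
      Halts (verifierProgram s) W (expand xs (a :: b :: st) = w.drop pos) T ⟨29, r', m'⟩) :
    Halts (verifierProgram s) W (expand xs (a :: b :: st) = w.drop pos) (T + 7)
      ⟨39, r, m⟩ := by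
  refine .store _ _ rfl htop hright ?_
  refine .add (3 + w.length + 2 * p.length + st.length + 1) rfl (by rw [htop, h.one])
    (by omega) ?_
  refine .store _ _ rfl (update_self ..) ((update_of_ne (by decide) ..).trans hleft) ?_
  refine .add (3 + w.length + 2 * p.length + (st.length + 2)) rfl (by simp [h.one]; omega)
    (by omega) ?_
  refine .add (3 + w.length + 2 * p.length + (st.length + 2) + (3 + pos)) rfl
    (by simp [hposition]) (by omega) ?_
  by_cases hle : pos + (st.length + 2) ≤ w.length
  · refine .jumpLT_of_le rfl (by simp [hlimit]; omega) ?_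
    refine .jump (l := 29) rfl ?_
    exact hnext _ _ { h.congr (by simp) fun i hi => by
        rw [update_of_ne (by omega), update_of_ne (by omega)] with
      position := by simp [hposition]
      stackTop := by simp
      limit := by simp [hlimit]
      stack := ⟨by simp [add_assoc], by simp,
        (hstack.update le_rfl).update (by omega)⟩
      fits := hle
      resolves := hres }
  · refine .jumpLT_of_lt (l := 17) rfl (by simp [hlimit]; omega) ?_
    refine .halt rfl ?_
    -- Each pointer on the stack contributes at least one letter, so the word would be too long.
    suffices expand xs (a :: b :: st) ≠ w.drop pos by simpa
    intro heq
    have hlen := length_le_length_expand hp hres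
    rw [heq, List.length_drop, List.length_cons, List.length_cons] at hlen
    omega

theorem Expanding.halts_of_step (hp : Plan.evalFrom [] p = some xs) {j : ℕ} {a b : Ptr α}
    (hW : 10 + 2 * w.length + 2 * p.length ≤ W) (hj : p[j]? = some (a, b))
    (h : Expanding e w k p xs pos (.step j :: st) r m)
    (hnext : ∀ r' m', Expanding e w k p xs pos (a :: b :: st) r' m' →
      Halts (verifierProgram s) W (expand xs (a :: b :: st) = w.drop pos) T ⟨29, r', m'⟩) :
    Halts (verifierProgram s) W (expand xs (.step j :: st) = w.drop pos) (T + 17)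
      ⟨29, r, m⟩ := by
  obtain ⟨hcode, hstack⟩ := h.stack
  obtain ⟨ha, hb⟩ := h.plan hj
  have hres := h.resolves_of_step hp hj
  have hfits := h.fits
  rw [List.length_cons] at hfits
  have hlt := (List.getElem?_eq_some_iff.1 hj).1
  rw [expand_step_cons hp hj]
  refine .jumpEQ_of_ne rfl (by simp [h.stackTop, h.stackBottom]) ?_
  refine .sub (3 + w.length + 2 * p.length + st.length) rfl
    (by simp only [h.stackTop, h.one, List.length_cons]; omega) ?_
  refine .load _ _ rfl (by simp) hcode ?_
  refine .jumpLT_of_le rfl (by simp [h.card, Ptr.code]) ?_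
  refine .sub j rfl (by simp [h.card, Ptr.code]) ?_
  refine .add (2 * j) rfl (by simp [two_mul]) (by omega) ?_
  refine .add (3 + w.length + 2 * j) rfl (by simp [h.wordEnd, add_comm]) (by omega) ?_
  refine .add (3 + w.length + 2 * j + 1) rfl (by simp [h.one]) (by omega) ?_
  refine .load _ _ rfl (by simp) hb ?_
  refine .load _ _ rfl (by simp) ha ?_
  exact (h.congr (by simp) fun _ _ => rfl).halts_of_push hp hW (by simp) (by simp)
    (by simp [h.position]) (by simp) (by simp [h.limit]) hstack (by omega) hres hnext

theorem Expanding.halts (hW : 10 + 2 * w.length + 2 * p.length ≤ W)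
    (hp : Plan.evalFrom [] p = some xs) (d : ℕ) (hd : 2 * w.length ≤ d + 2 * pos + st.length)
    (h : Expanding e w k p xs pos st r m) :
    Halts (verifierProgram s) W (expand xs st = w.drop pos) (17 * d + 3) ⟨29, r, m⟩ := by
  induction d generalizing r m pos st with
  | zero =>
    have hfits := h.fits
    obtain rfl : st = [] := List.length_eq_zero_iff.1 (by omega)
    exact h.halts_of_nil
  | succ d ih =>
    rcases st with _ | ⟨a | j, st⟩
    · exact h.halts_of_nil.mono (by omega)
    · rw [List.length_cons] at hd
      exact (h.halts_of_letter (by omega) fun _ h' => ih (by omega) h').mono (by omega)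
    · have hj : j < p.length := by
        simpa [Ptr.resolve, Plan.length_of_evalFrom hp] using
          (List.forall_mem_cons.1 h.resolves).1
      refine (h.halts_of_step hp hW (List.getElem?_eq_getElem hj) fun _ _ h' =>
        ih ?_ h').mono (by omega)
      simp only [List.length_cons] at hd ⊢
      omega

theorem builds_iff_expand_eq (hp : Plan.evalFrom [] p = some xs) (hpos : 1 ≤ p.length) :
    p.Builds w ↔ expand xs [.step (p.length - 1)] = w := by
  have hlast : xs.length - 1 < xs.length := by rw [Plan.length_of_evalFrom hp]; omega
  rw [← Plan.length_of_evalFrom hp, expand_cons (a := .step _) (List.getElem?_eq_getElem hlast)]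
  simp [Plan.Builds, hp, List.getLast?_eq_getElem?, hlast, expand]

theorem Checking.halts_of_all_checked (hW : 10 + 2 * w.length + 2 * p.length ≤ W)
    (hpos : 1 ≤ p.length) (hw : 1 ≤ w.length) (h : Checking e w k p p.length r m) :
    Halts (verifierProgram s) W (p.Builds w) (34 * w.length + 8) ⟨14, r, m⟩ := by
  obtain ⟨xs, hp⟩ := h.legal
  rw [List.take_length] at hp
  have hstep : p.length - 1 < xs.length := by rw [Plan.length_of_evalFrom hp]; omega
  have hbuilds : p.Builds w ↔ expand xs [.step (p.length - 1)] = w.drop 0 :=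
    builds_iff_expand_eq hp hpos
  rw [hbuilds]
  refine .jumpEQ_of_eq (l := 25) rfl (by rw [h.pointer, h.stackBottom]) ?_
  refine .sub (s + (p.length - 1)) rfl (by rw [h.bound, h.one]; omega) ?_
  refine .store _ _ rfl ((update_of_ne (by decide) ..).trans h.stackBottom) (update_self ..) ?_
  refine .add (3 + w.length + 2 * p.length + 1) rfl (by simp [h.stackBottom, h.one])
    (by omega) ?_
  refine .add (6 + 2 * w.length + 2 * p.length) rfl
    (by simp [h.wordEnd, h.stackBottom]; omega) (by omega) ?_
  exact .mono (Expanding.halts hW hp (2 * w.length) (by simp)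
    { h.congr (by simp) fun _ hi => update_of_ne hi.ne .. with
      position := by simp [h.position]
      stackTop := by simp
      limit := by simp
      stack := ⟨by simp [Ptr.code], trivial⟩
      fits := by simpa using hw
      resolves := by simpa [Ptr.resolve] using hstep }) (by omega)

theorem Checking.halts_of_lt (hW : 10 + 2 * w.length + 2 * p.length + s ≤ W) {i : ℕ}
    (hi : i < p.length) (h : Checking e w k p i r m)
    (hnext : ∀ r', Checking e w k p (i + 1) r' m →
      Halts (verifierProgram s) W (p.Builds w) T ⟨14, r', m⟩) :
    Halts (verifierProgram s) W (p.Builds w) (T + 9) ⟨14, r, m⟩ := by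
  obtain ⟨xs, hxs⟩ := h.legal
  obtain ⟨⟨a, b⟩, hab⟩ : ∃ ab, p[i]? = some ab := ⟨_, List.getElem?_eq_getElem hi⟩
  obtain ⟨ha, hb⟩ := h.plan hab
  have hlegal : (∃ ys, Plan.evalFrom [] (p.take (i + 1)) = some ys) ↔
      a.code e < s + i ∧ b.code e < s + i := by
    rw [Plan.exists_evalFrom_take_succ_iff hab hxs, Ptr.isSome_resolve_iff e,
      Ptr.isSome_resolve_iff e, Plan.length_of_evalFrom hxs, List.length_take_of_le hi.le]
  have hbuilds (hb : p.Builds w) := hlegal.1 (Plan.exists_evalFrom_take_of_builds hb (i + 1))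
  refine .jumpEQ_of_ne rfl (by rw [h.stackBottom, h.pointer]; omega) ?_
  refine .load _ _ rfl h.pointer ha ?_
  by_cases hca : a.code e < s + i
  swap
  · refine .jumpLT_of_le rfl (by simpa [h.bound] using hca) ?_
    exact .halt rfl (by simpa using fun hb => hca (hbuilds hb).1)
  refine .jumpLT_of_lt (l := 18) rfl (by simpa [h.bound] using hca) ?_
  refine .add (3 + w.length + 2 * i + 1) rfl (by simp [h.one, h.pointer]) (by omega) ?_
  refine .load _ _ rfl (by simp) hb ?_
  by_cases hcb : b.code e < s + i
  swap
  · refine .jumpLT_of_le rfl (by simpa [h.bound] using hcb) ?_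
    exact .halt rfl (by simpa using fun hb => hcb (hbuilds hb).2)
  refine .jumpLT_of_lt (l := 22) rfl (by simpa [h.bound] using hcb) ?_
  refine .add (3 + w.length + 2 * (i + 1)) rfl (by simp [h.one]; omega) (by omega) ?_
  refine .add (s + (i + 1)) rfl (by simp [h.one, h.bound]; omega) (by omega) ?_
  refine .jump (l := 14) rfl ?_
  exact hnext _ { h.congr (by simp) fun _ _ => rfl with
    pointer := by simp
    bound := by simp
    position := by simp [h.position]
    legal := hlegal.2 ⟨hca, hcb⟩ }

theorem Checking.halts (hW : 10 + 2 * w.length + 2 * p.length + s ≤ W) (hpos : 1 ≤ p.length)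
    (hw : 1 ≤ w.length) (d i : ℕ) (hd : i + d = p.length) (h : Checking e w k p i r m) :
    Halts (verifierProgram s) W (p.Builds w) (34 * w.length + 8 + 9 * d) ⟨14, r, m⟩ := by
  induction d generalizing r i with
  | zero =>
    obtain rfl : i = p.length := hd
    exact h.halts_of_all_checked (by omega) hpos hw
  | succ d ih => exact h.halts_of_lt hW (by omega) fun _ h' => ih (i + 1) (by omega) h'

theorem halts_verifierProgram (hk : k < w.length) (hW : 10 + 4 * w.length + s ≤ W) :
    Halts (verifierProgram s) W (p.length ≤ k ∧ p.Builds w) (43 * w.length + 22)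
      (init (verifierInput e w k p)) := by
  rw [init]
  refine .const rfl (by omega) ?_
  refine .const rfl (by omega) ?_
  refine .load 0 w.length rfl rfl rfl ?_
  refine .load 1 k rfl rfl rfl ?_
  refine .add 2 rfl rfl (by omega) ?_
  refine .load 2 p.length rfl rfl rfl ?_
  by_cases hpk : p.length ≤ k
  swap
  · refine .jumpLT_of_lt (l := 17) rfl (by simpa [update_apply] using hpk) ?_
    exact .halt rfl (by simp [hpk])
  refine .jumpLT_of_le rfl (by simpa [update_apply] using hpk) ?_
  rcases Nat.eq_zero_or_pos p.length with hp | hp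
  · refine .jumpEQ_of_eq (l := 17) rfl (by simpa [update_apply] using hp) ?_
    obtain rfl := List.length_eq_zero_iff.1 hp
    exact .halt rfl (by simp [Plan.Builds, Plan.evalFrom])
  refine .jumpEQ_of_ne rfl (by simpa [update_apply] using hp.ne') ?_
  refine .const rfl (by omega) ?_
  refine .add (3 + w.length) rfl rfl (by omega) ?_
  refine .move (3 + w.length) rfl rfl ?_
  refine .add (3 + w.length + p.length) rfl rfl (by omega) ?_
  refine .add (3 + w.length + 2 * p.length) rfl (by simp; omega) (by omega) ?_
  refine .move s rfl rfl ?_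
  simp only [hpk, true_and]
  exact .mono (Checking.halts (k := k) (by omega) hp (by omega) p.length 0 (by omega)
    { one := rfl, card := rfl, wordEnd := rfl, stackBottom := rfl, input := fun _ _ => rfl
      pointer := rfl, bound := rfl, position := rfl, legal := ⟨[], rfl⟩ }) (by omega)

theorem decidesWithin_verifierProgram (hk : k + 2 ≤ w.length) :
    DecidesWithin (verifierProgram s) (verifierInput e w k p) (p.length ≤ k ∧ p.Builds w)
      ((2 * s + 65) * w.length ^ 2) :=
  (halts_verifierProgram (by omega) le_rfl).decidesWithin.imp fun _ h =>
    h.imp_left fun hm => hm.trans (by nlinarith)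

theorem wordsBoundedBy_verifierProgram (hk : k + 2 ≤ w.length) {M : ℕ}
    (hM : ∀ x ∈ verifierInput e w k p, x ≤ M) :
    WordsBoundedBy (verifierProgram s) (verifierInput e w k p)
      (max M ((2 * s + 65) * w.length ^ 2)) := by
  have hW : 10 + 4 * w.length + s ≤ (2 * s + 65) * w.length ^ 2 := by
    have hs : s * 1 ≤ s * w.length ^ 2 := Nat.mul_le_mul_left s (Nat.one_le_pow _ _ (by omega))
    nlinarith
  exact (halts_verifierProgram (by omega) (hW.trans (le_max_right _ _))).wordsBoundedBy
    fun x hx => (hM x hx).trans (le_max_left _ _)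

end Verifier

end Assembly

open Assembly in
theorem mainTheorem4 (α : Type) [Fintype α] :
    -- the problem is in NP
    InNP (asiDecLanguage α) ∧
    -- if `k ≥ n - 1`, the instance is a yes-instance
    (∀ (w : List α) (k : ℕ), w ≠ [] → w.length ≤ k + 1 → (w, k) ∈ ASIDec α) ∧
    -- otherwise, the witnesses are the plans of at most `k` steps given by pointers
    (∀ (w : List α) (k : ℕ), k + 2 ≤ w.length →
      ((w, k) ∈ ASIDec α ↔ ∃ p : Plan α, p.length ≤ k ∧ p.Builds w)) ∧
    -- they have `O(n log n)` bits, and are checked in time `O(n ^ 2)`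
    ∃ (P : RAM.Program) (C : ℕ), ∀ (e : α ≃ Fin (Fintype.card α)) (w : List α) (k : ℕ),
      k + 2 ≤ w.length → ∀ p : Plan α,
        (p.length ≤ k → (p.bits e).length ≤ C * w.length * Nat.log 2 w.length) ∧
        RAM.DecidesWithin P (verifierInput e w k p) (p.length ≤ k ∧ p.Builds w)
          (C * w.length ^ 2) ∧
        ∀ M : ℕ, (∀ x ∈ verifierInput e w k p, x ≤ M) →
          RAM.WordsBoundedBy P (verifierInput e w k p) (max M (C * w.length ^ 2)) := by
  refine ⟨inNP_asiDecLanguage α, fun _ _ => mem_asiDec_of_length_le,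
    fun _ _ hk => mem_asiDec_iff_exists_plan (by omega), verifierProgram (Fintype.card α),
    2 * Fintype.card α + 65, fun e w k hk p => ⟨fun hp => ?_, ?_, fun M hM => ?_⟩⟩
  · exact (Plan.length_bits_le e w p (by omega) (by omega)).trans (by gcongr; omega)
  · exact decidesWithin_verifierProgram hk
  · exact wordsBoundedBy_verifierProgram hk hM
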